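/- Let $\mathbb{QU}$ denote the rational Urysohn metric space, i.e. the (unique up to isometry) countable metric space with only rational distances such that, whenever $X$ is a finite (possibly empty) metric space, $Y=X\cup\{y\}$ is a one-point metric extension of $X$ all of whose distances are rational, and $\phi\colon X\to\mathbb{QU}$ is an isometric embedding, $\phi$ extends to an isometric embedding of $Y$ into $\mathbb{QU}$. Equip the group $\mathrm{Isom}(\mathbb{QU})$ of surjective isometries with the permutation group topology, whose basic open sets are $\{g : g(x_i)=f(x_i),\ i\le n\}$ for $f\in\mathrm{Isom}(\mathbb{QU})$ and $x_1,\dots,x_n\in\mathbb{QU}$. For a group $\Gamma$, let $\mathrm{Isom}(\Gamma,\mathbb{QU})$ be the space of all homomorphisms $\Gamma\to\mathrm{Isom}(\mathbb{QU})$ (isometric actions of $\Gamma$ on $\mathbb{QU}$), topologised as a subspace of the product $\mathrm{Isom}(\mathbb{QU})^\Gamma$; the group $\mathrm{Isom}(\mathbb{QU})$ acts on it by conjugation, $(a\cdot\pi)(g)=a\pi(g)a^{-1}$. An element $\pi\in\mathrm{Isom}(\Gamma,\mathbb{QU})$ is \emph{generic} if its conjugacy orbit $\mathrm{Isom}(\mathbb{QU})\cdot\pi$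 is comeagre in $\mathrm{Isom}(\Gamma,\mathbb{QU})$. A group $\Gamma$ has the \emph{Ribes--Zalesski\u{\i} property} (RZ) if every product $H_1H_2\cdots H_n$ of finitely generated subgroups $H_i\leqslant\Gamma$ is closed in the profinite topology on $\Gamma$, i.e. the topology generated by the cosets $gK$ of normal subgroups $K\leqslant\Gamma$ of finite index. **Theorem.** Let $\Gamma$ be a finitely generated group with property (RZ). Then there is a generic representation $\pi\in\mathrm{Isom}(\Gamma,\mathbb{QU})$, and moreover $\pi$ can be chosen so that every orbit of $\Gamma$ under the action $\pi$ on $\mathbb{QU}$ is finite. In particular, this applies to every finitely generated Abelian group $\Gamma$: such a group has property (RZ), and hence has a generic representation in $\mathrm{Isom}(\mathbb{QU})$ all of whose orbits on $\mathbb{QU}$ are finite. -/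

import Mathlib

open scoped Pointwise

/-! ### The rational Urysohn space -/

/-- All distances of the metric space `X` are rational numbers. -/
def HasRationalDistances (X : Type*) [MetricSpace X] : Prop :=
  ∀ x y : X, ∃ q : ℚ, dist x y = q

/-- `U` is the rational Urysohn metric space: a countable metric space with rational distances
such that, whenever `Y = X ∪ {y}` is a finite metric space with rational distances which is a
one-point extension of `X = Y \ {y}`, every isometric embedding of `X` into `U` extends to an
isometric embedding of `Y` into `U`. (The case `X = ∅` says that `U` is nonempty.)
These properties determine `U` up to isometry; existence is `exists_isRationalUrysohn` below. -/
structure IsRationalUrysohn (U : Type*) [MetricSpace U] : Prop where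
  countable : Countable U
  rational : HasRationalDistances U
  extension : ∀ (Y : Type) [MetricSpace Y] [Finite Y], HasRationalDistances Y →
    ∀ (y : Y) (φ : {x : Y // x ≠ y} → U), Isometry φ →
      ∃ ψ : Y → U, Isometry ψ ∧ ∀ x : {x : Y // x ≠ y}, ψ x = φ x

/-! ### Representations and genericity -/

/-- The permutation group topology on the isometry group of `U`: the basic open sets are
`{g | g x₁ = f x₁, …, g xₙ = f xₙ}`. -/
instance isomPermTopology (U : Type*) [MetricSpace U] : TopologicalSpace (U ≃ᵢ U) :=
  TopologicalSpace.generateFrom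
    {s | ∃ (f : U ≃ᵢ U) (A : Finset U), s = {g : U ≃ᵢ U | ∀ x ∈ A, g x = f x}}

/-- The topology of the space `Rep(Γ, G)` of representations of the discrete group `Γ` in the
topological group `G`, as a subspace of the product `G ^ Γ`. -/
instance repTopology (Γ G : Type*) [Group Γ] [Group G] [TopologicalSpace G] :
    TopologicalSpace (Γ →* G) :=
  TopologicalSpace.induced (fun (π : Γ →* G) (g : Γ) => π g) Pi.topologicalSpace

/-- The orbit of a representation under the diagonal conjugacy action of `G`. -/
def conjOrbit {Γ G : Type*} [Group Γ] [Group G] (π : Γ →* G) : Set (Γ →* G) :=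
  {θ | ∃ a : G, ∀ g : Γ, a * π g * a⁻¹ = θ g}

/-- A representation is generic if its conjugacy orbit is comeagre in `Rep(Γ, G)`. -/
def IsGenericRep {Γ G : Type*} [Group Γ] [Group G] [TopologicalSpace G] (π : Γ →* G) : Prop :=
  conjOrbit π ∈ residual (Γ →* G)

/-! ### The profinite topology and property (RZ) -/

/-- The profinite topology on `Γ`, generated by the cosets of the normal subgroups of finite
index. -/
@[reducible]
def profiniteTopology (Γ : Type*) [Group Γ] : TopologicalSpace Γ :=
  TopologicalSpace.generateFrom
    {s | ∃ (K : Subgroup Γ) (g : Γ), K.Normal ∧ K.FiniteIndex ∧ s = g • (K : Set Γ)}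

/-- The Ribes–Zalesskiĭ property: each product `H₁ H₂ ⋯ Hₙ` of finitely generated subgroups is
closed in the profinite topology. -/
def HasRZ (Γ : Type*) [Group Γ] : Prop :=
  ∀ l : List (Subgroup Γ), (∀ H ∈ l, H.FG) →
    @IsClosed Γ (profiniteTopology Γ) (l.map (fun H : Subgroup Γ => (H : Set Γ))).prod

/-! ### Existence of the rational Urysohn space

The metric is built on the natural numbers, one point at a time. -/

namespace RationalUrysohnConstruction

/-- `d` restricts to a metric on `{0, …, n}`. -/
structure IsMet (n : ℕ) (d : ℕ → ℕ → ℚ) : Prop where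
  self : ∀ a ≤ n, d a a = 0
  pos : ∀ a ≤ n, ∀ b ≤ n, a ≠ b → 0 < d a b
  symm : ∀ a ≤ n, ∀ b ≤ n, d a b = d b a
  tri : ∀ a ≤ n, ∀ b ≤ n, ∀ c ≤ n, d a c ≤ d a b + d b c

/-- `L` is the graph of the distance function of a one-point extension of a nonempty subset of
`{0, …, n}`. -/
structure Valid (n : ℕ) (d : ℕ → ℕ → ℚ) (L : Finset (ℕ × ℚ)) : Prop where
  ne : L.Nonempty
  le : ∀ p ∈ L, p.1 ≤ n
  pos : ∀ p ∈ L, 0 < p.2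
  sub : ∀ p ∈ L, ∀ q ∈ L, p.2 ≤ q.2 + d q.1 p.1
  add : ∀ p ∈ L, ∀ q ∈ L, d p.1 q.1 ≤ p.2 + q.2

open Classical in
/-- The distance from the new point to `x`. -/
noncomputable def newDist (d : ℕ → ℕ → ℚ) (L : Finset (ℕ × ℚ)) (x : ℕ) : ℚ :=
  if h : L.Nonempty then L.inf' h (fun p => p.2 + d p.1 x) else 0

/-- Extend `d` by the point `n`. -/
noncomputable def ext (n : ℕ) (d : ℕ → ℕ → ℚ) (L : Finset (ℕ × ℚ)) (a b : ℕ) : ℚ :=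
  if a = n then (if b = n then 0 else newDist d L b)
  else if b = n then newDist d L a else d a b

theorem newDist_le {n d L} (hL : Valid n d L) {p} (hp : p ∈ L) (x : ℕ) :
    newDist d L x ≤ p.2 + d p.1 x := by
  rw [newDist, dif_pos hL.ne]
  exact Finset.inf'_le (fun p : ℕ × ℚ => p.2 + d p.1 x) hp

theorem newDist_eq {n d L} (hL : Valid n d L) (x : ℕ) :
    ∃ p ∈ L, newDist d L x = p.2 + d p.1 x := by
  rw [newDist, dif_pos hL.ne]
  exact Finset.exists_mem_eq_inf' hL.ne _

theorem newDist_mem {n d L} (hd : IsMet n d) (hL : Valid n d L) {p} (hp : p ∈ L) :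
    newDist d L p.1 = p.2 := by
  apply le_antisymm
  · have := newDist_le hL hp p.1
    rwa [hd.self _ (hL.le p hp), add_zero] at this
  · obtain ⟨q, hq, h⟩ := newDist_eq hL p.1
    rw [h]
    exact hL.sub p hp q hq

theorem IsMet.nonneg {n d} (hd : IsMet n d) {a b : ℕ} (ha : a ≤ n) (hb : b ≤ n) :
    0 ≤ d a b := by
  by_cases h : a = b
  · subst h; exact (hd.self a ha).ge
  · exact (hd.pos a ha b hb h).le

theorem IsMet.ext {n d L} (hd : IsMet n d) (hL : Valid n d L) :
    IsMet (n + 1) (ext (n + 1) d L) := by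
  have hpos : ∀ x ≤ n, 0 < newDist d L x := by
    intro x hx
    obtain ⟨p, hp, h⟩ := newDist_eq hL x
    have := hL.pos p hp
    have := hd.nonneg (hL.le p hp) hx
    linarith
  have h1 : ∀ x ≤ n, ∀ y ≤ n, newDist d L x ≤ newDist d L y + d y x := by
    intro x hx y hy
    obtain ⟨p, hp, h⟩ := newDist_eq hL y
    have := newDist_le hL hp x
    have := hd.tri p.1 (hL.le p hp) y hy x hx
    linarith
  have h2 : ∀ x ≤ n, ∀ y ≤ n, d x y ≤ newDist d L x + newDist d L y := by
    intro x hx y hy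
    obtain ⟨p, hp, h⟩ := newDist_eq hL x
    obtain ⟨q, hq, h'⟩ := newDist_eq hL y
    have := hL.add p hp q hq
    have := hd.tri x hx p.1 (hL.le p hp) y hy
    have := hd.tri p.1 (hL.le p hp) q.1 (hL.le q hq) y hy
    have := hd.symm x hx p.1 (hL.le p hp)
    linarith
  have key : ∀ a ≤ n + 1, a ≠ n + 1 → a ≤ n := by omega
  constructor
  · intro a ha
    by_cases h : a = n + 1
    · simp [RationalUrysohnConstruction.ext, h]
    · simp [RationalUrysohnConstruction.ext, h, hd.self a (key a ha h)]
  · intro a ha b hb hab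
    by_cases h : a = n + 1 <;> by_cases h' : b = n + 1
    · omega
    · simp [RationalUrysohnConstruction.ext, h, h', hpos b (key b hb h')]
    · simp [RationalUrysohnConstruction.ext, h, h', hpos a (key a ha h)]
    · simp [RationalUrysohnConstruction.ext, h, h', hd.pos a (key a ha h) b (key b hb h') hab]
  · intro a ha b hb
    by_cases h : a = n + 1 <;> by_cases h' : b = n + 1
    · simp [RationalUrysohnConstruction.ext, h, h']
    · simp [RationalUrysohnConstruction.ext, h, h']
    · simp [RationalUrysohnConstruction.ext, h, h']
    · simp [RationalUrysohnConstruction.ext, h, h', hd.symm a (key a ha h) b (key b hb h')]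
  · intro a ha b hb c hc
    by_cases h : a = n + 1 <;> by_cases h' : b = n + 1 <;> by_cases h'' : c = n + 1 <;>
      simp only [RationalUrysohnConstruction.ext, h, h', h'', if_true, if_false]
    · simp
    · simp
    · have := hpos b (key b hb h'); linarith
    · exact h1 c (key c hc h'') b (key b hb h')
    · simp
    · exact h2 a (key a ha h) c (key c hc h'')
    · have := h1 a (key a ha h) b (key b hb h')
      have := hd.symm a (key a ha h) b (key b hb h')
      linarith
    · exact hd.tri a (key a ha h) b (key b hb h') c (key c hc h'')

theorem valid_default {n d} (hd : IsMet n d) : Valid n d {(0, 1)} := by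
  have := hd.self 0 (Nat.zero_le n)
  constructor <;> simp [this]

open Classical in
/-- The metric on `{0, …, n}`, where `e` lists the extensions to be realised. -/
noncomputable def seq (e : ℕ → Finset (ℕ × ℚ)) : ℕ → ℕ → ℕ → ℚ
  | 0 => fun _ _ => 0
  | n + 1 => ext (n + 1) (seq e n) (if Valid n (seq e n) (e n) then e n else {(0, 1)})

theorem isMet_seq (e : ℕ → Finset (ℕ × ℚ)) (n : ℕ) : IsMet n (seq e n) := by
  induction n with
  | zero =>
    constructor <;> simp [seq]
  | succ n ih =>
    rw [seq]
    split_ifs with h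
    · exact ih.ext h
    · exact ih.ext (valid_default ih)

/-- The limit metric. -/
noncomputable def lim (e : ℕ → Finset (ℕ × ℚ)) (a b : ℕ) : ℚ := seq e (max a b) a b

theorem seq_eq_lim (e : ℕ → Finset (ℕ × ℚ)) {n a b : ℕ} (ha : a ≤ n) (hb : b ≤ n) :
    seq e n a b = lim e a b := by
  have h : max a b ≤ n := max_le ha hb
  induction n, h using Nat.le_induction with
  | base => rfl
  | succ n hn ih =>
    have h1 : a ≤ n := le_trans (le_max_left _ _) hn
    have h2 : b ≤ n := le_trans (le_max_right _ _) hn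
    rw [seq, ext, if_neg (by omega), if_neg (by omega), ih h1 h2]

/-- The underlying set of the space constructed here. -/
structure Point where
  idx : ℕ

/-- The metric space given by `lim e`. -/
@[reducible]
noncomputable def metric (e : ℕ → Finset (ℕ × ℚ)) : MetricSpace Point where
  dist x y := (lim e x.idx y.idx : ℝ)
  dist_self x := by
    have := (isMet_seq e (max x.idx x.idx)).self x.idx (le_max_left _ _)
    exact_mod_cast this
  dist_comm x y := by
    have := (isMet_seq e (max x.idx y.idx)).symm x.idx (le_max_left _ _) y.idx (le_max_right _ _)
    rw [seq_eq_lim e (le_max_left _ _) (le_max_right _ _),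
      seq_eq_lim e (le_max_right _ _) (le_max_left _ _)] at this
    exact_mod_cast this
  dist_triangle x y z := by
    set n := max x.idx (max y.idx z.idx) with hn
    have hx : x.idx ≤ n := by omega
    have hy : y.idx ≤ n := by omega
    have hz : z.idx ≤ n := by omega
    have := (isMet_seq e n).tri x.idx hx y.idx hy z.idx hz
    rw [seq_eq_lim e hx hz, seq_eq_lim e hx hy, seq_eq_lim e hy hz] at this
    exact_mod_cast this
  eq_of_dist_eq_zero := by
    intro x y h
    have h' : lim e x.idx y.idx = 0 := by exact_mod_cast h
    by_contra hxy
    have hne : x.idx ≠ y.idx := by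
      intro h; apply hxy; cases x; cases y; simp_all
    have := (isMet_seq e (max x.idx y.idx)).pos x.idx (le_max_left _ _) y.idx (le_max_right _ _) hne
    rw [seq_eq_lim e (le_max_left _ _) (le_max_right _ _), h'] at this
    exact lt_irrefl _ this

end RationalUrysohnConstruction

open RationalUrysohnConstruction in
/-- The rational Urysohn space exists. -/
theorem exists_isRationalUrysohn : ∃ (U : Type) (_ : MetricSpace U), IsRationalUrysohn U := by
  classical
  obtain ⟨e₀, he₀⟩ := exists_surjective_nat (Finset (ℕ × ℚ))
  let e : ℕ → Finset (ℕ × ℚ) := fun n => e₀ n.unpair.1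
  have he : ∀ (L : Finset (ℕ × ℚ)) (m : ℕ), ∃ n, m ≤ n ∧ e n = L := by
    intro L m
    obtain ⟨k, hk⟩ := he₀ L
    exact ⟨Nat.pair k m, Nat.right_le_pair k m, by simp [e, hk]⟩
  let _ : MetricSpace Point := metric e
  have hdist : ∀ x y : Point, dist x y = (lim e x.idx y.idx : ℝ) := fun _ _ => rfl
  refine ⟨Point, metric e, ?_, fun x y => ⟨_, hdist x y⟩, ?_⟩
  · exact Function.Injective.countable (f := Point.idx) (by rintro ⟨a⟩ ⟨b⟩ h; simp_all)
  intro Y _ _ hY y φ hφ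
  rcases isEmpty_or_nonempty {x : Y // x ≠ y} with hX | ⟨⟨x₀⟩⟩
  · refine ⟨fun _ => ⟨0⟩, ?_, fun x => hX.elim x⟩
    have : ∀ a : Y, a = y := fun a => by
      by_contra h; exact hX.elim ⟨a, h⟩
    refine Isometry.of_dist_eq fun a b => ?_
    rw [this a, this b, dist_self, dist_self]
  choose r hr using fun x : Y => hY x y
  have := Fintype.ofFinite Y
  let L : Finset (ℕ × ℚ) := Finset.univ.image fun x : {x : Y // x ≠ y} => ((φ x).idx, r x)
  obtain ⟨m, hm⟩ : ∃ m, ∀ x, (φ x).idx ≤ m :=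
    ⟨Finset.univ.sup fun x => (φ x).idx, fun x =>
      Finset.le_sup (f := fun x => (φ x).idx) (Finset.mem_univ x)⟩
  obtain ⟨n, hn, hen⟩ := he L m
  have hL : ∀ p ∈ L, ∃ x, p = ((φ x).idx, r x) := by
    intro p hp
    obtain ⟨x, -, rfl⟩ := Finset.mem_image.1 hp
    exact ⟨x, rfl⟩
  have hmem : ∀ x, ((φ x).idx, r x) ∈ L := fun x =>
    Finset.mem_image_of_mem (fun x : {x : Y // x ≠ y} => ((φ x).idx, r x)) (Finset.mem_univ x)
  have hle : ∀ x, (φ x).idx ≤ n := fun x => (hm x).trans hn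
  have hd : ∀ x x', (seq e n (φ x).idx (φ x').idx : ℝ) = dist (x : Y) x' := by
    intro x x'
    rw [seq_eq_lim e (hle x) (hle x'), ← hdist, hφ.dist_eq]
    rfl
  have hval : Valid n (seq e n) L := by
    constructor
    · exact ⟨_, hmem x₀⟩
    · intro p hp
      obtain ⟨x, rfl⟩ := hL p hp
      exact hle x
    · intro p hp
      obtain ⟨x, rfl⟩ := hL p hp
      have h : (0 : ℝ) < r x := by rw [← hr]; exact dist_pos.2 x.2
      exact_mod_cast h
    · intro p hp q hq
      obtain ⟨x, rfl⟩ := hL p hp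
      obtain ⟨x', rfl⟩ := hL q hq
      have h : (r x : ℝ) ≤ r x' + seq e n (φ x').idx (φ x).idx := by
        rw [hd, ← hr, ← hr, dist_comm (x' : Y) x]
        linarith [dist_triangle (x : Y) x' y]
      exact_mod_cast h
    · intro p hp q hq
      obtain ⟨x, rfl⟩ := hL p hp
      obtain ⟨x', rfl⟩ := hL q hq
      have h : (seq e n (φ x).idx (φ x').idx : ℝ) ≤ r x + r x' := by
        rw [hd, ← hr, ← hr]
        exact dist_triangle_right _ _ _
      exact_mod_cast h
  have hnew : ∀ x : {x : Y // x ≠ y}, dist (⟨n + 1⟩ : Point) (φ x) = dist (x : Y) y := by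
    intro x
    rw [hdist, hr, ← seq_eq_lim e (n := n + 1) le_rfl ((hle x).trans (Nat.le_succ n)), seq,
      hen, if_pos hval, ext, if_pos rfl, if_neg (by have := hle x; omega)]
    have := newDist_mem (isMet_seq e n) hval (hmem x)
    exact_mod_cast this
  refine ⟨fun x => if h : x = y then ⟨n + 1⟩ else φ ⟨x, h⟩, ?_, fun x => dif_neg x.2⟩
  refine Isometry.of_dist_eq fun a b => ?_
  by_cases ha : a = y <;> by_cases hb : b = y
  · simp [ha, hb]
  · rw [dif_pos ha, dif_neg hb, hnew, ha, dist_comm]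
  · rw [dif_neg ha, dif_pos hb, dist_comm, hnew, hb]
  · rw [dif_neg ha, dif_neg hb, hφ.dist_eq]
    rfl

/-! The generic class is described explicitly. A representation is rich (`IsRich`) if its orbits are
finite and every finite action in `U` extending one of its finite subactions embeds into it over
that subaction. Rich representations play the role of a Fraïssé limit of the finite rational metric
spaces with an isometric action of `Γ`.

Finite actions have amalgams (`FinAction.exists_amalgam`) and can absorb any point of `U`
(`FinAction.exists_mem_carrier`). Since `Γ` is finitely generated there are countably many of them,
so an ideal meeting countably many cofinal sets has a rich representation as its union, starting
from any given finite action (`FinAction.exists_isRich`). A back-and-forth argument conjugates any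
two rich representations (`IsRich.mem_conjOrbit`), and richness is a Gδ condition
(`isGδ_setOf_isRich`). Hence a rich representation is generic as soon as rich ones are dense, that
is, as soon as every representation agrees on any finite amount of data with a finite action
(`IsRich.isGenericRep`).

Property (RZ) supplies this approximation (`HasRZ.exists_finAction`). Given the finite set `X` of
points under observation, each orbit meeting `X` is modelled by cosets of a finitely generated
subgroup `H i` of a point stabiliser, and replaced by the finite set `Γ ⧸ (K ⊔ H i)` with `K` normal
of finite index. This carries the path metric generated by the translates of the distances in `X`.
The copy of `X` keeps its distances unless some short chain of translated edges closes up in the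
quotient without closing up in `Γ`. Closing up says that `1` lies in a product of cosets of the `H
i`, up to conjugation a translate of a product of finitely generated subgroups. By (RZ) such
products not containing `1` can be separated from it by a finite-index `K`, and only finitely many
chains matter. -/

/-! ### Finite rational metric spaces inside the rational Urysohn space -/

/-- `D` is a metric on `Z` with rational values. -/
structure IsRationalMetric {Z : Type*} (D : Z → Z → ℝ) : Prop where
  self : ∀ x, D x x = 0
  pos : ∀ x y, x ≠ y → 0 < D x y
  symm : ∀ x y, D x y = D y x
  tri : ∀ x y z, D x z ≤ D x y + D y z
  rat : ∀ x y, ∃ q : ℚ, D x y = q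

/-- The metric space given by a rational metric. -/
@[reducible]
noncomputable def IsRationalMetric.metricSpace {Z : Type*} {D : Z → Z → ℝ}
    (h : IsRationalMetric D) : MetricSpace Z where
  dist := D
  dist_self := h.self
  dist_comm := h.symm
  dist_triangle := h.tri
  eq_of_dist_eq_zero := by
    intro x y hxy
    by_contra hne
    exact (h.pos x y hne).ne' hxy

theorem isRationalMetric_dist {U I : Type*} [MetricSpace U] (hU : HasRationalDistances U)
    {a : I → U} (ha : Function.Injective a) : IsRationalMetric fun i j => dist (a i) (a j) where
  self _ := dist_self _
  pos _ _ h := dist_pos.2 (ha.ne h)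
  symm _ _ := dist_comm _ _
  tri _ _ _ := dist_triangle _ _ _
  rat _ _ := hU _ _

/-- Add one point to a rational metric. -/
theorem IsRationalMetric.option {Z : Type*} {D : Z → Z → ℝ} (h : IsRationalMetric D) {f : Z → ℝ}
    (hpos : ∀ i, 0 < f i) (hrat : ∀ i, ∃ q : ℚ, f i = q)
    (hsub : ∀ i j, f i ≤ f j + D j i) (hadd : ∀ i j, D i j ≤ f i + f j) :
    IsRationalMetric (Z := Option Z) fun x y =>
      match x, y with
      | none, none => 0
      | none, some j => f j
      | some i, none => f i
      | some i, some j => D i j where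
  self x := by cases x <;> simp [h.self]
  pos x y hxy := by
    cases x <;> cases y
    · exact absurd rfl hxy
    · exact hpos _
    · exact hpos _
    · exact h.pos _ _ (fun h => hxy (by rw [h]))
  symm x y := by cases x <;> cases y <;> first | rfl | exact h.symm _ _
  tri x y z := by
    rcases x with _ | x <;> rcases y with _ | y <;> rcases z with _ | z <;> dsimp only
    · simp
    · simp
    · linarith [hpos y]
    · exact hsub _ _
    · simp
    · exact hadd _ _
    · linarith [hsub x y, h.symm x y]
    · exact h.tri _ _ _
  rat x y := by
    cases x <;> cases y
    · exact ⟨0, by simp⟩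
    · exact hrat _
    · exact hrat _
    · exact h.rat _ _

namespace IsRationalUrysohn

variable {U : Type*} [MetricSpace U] (hU : IsRationalUrysohn U)
include hU

theorem exists_dist_eq_of_injective {I : Type*} [Finite I] {a : I → U}
    (ha : Function.Injective a) {f : I → ℝ} (hpos : ∀ i, 0 < f i) (hrat : ∀ i, ∃ q : ℚ, f i = q)
    (hsub : ∀ i j, f i ≤ f j + dist (a j) (a i)) (hadd : ∀ i j, dist (a i) (a j) ≤ f i + f j) :
    ∃ u, ∀ i, dist u (a i) = f i := by
  -- The extension property speaks of spaces in `Type` only, while `I` may live in any universe;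
  -- hence the passage to `Fin n`.
  obtain ⟨n, ⟨e⟩⟩ := Finite.exists_equiv_fin I
  have hD := (isRationalMetric_dist hU.rational (ha.comp e.symm.injective)).option
    (f := f ∘ e.symm) (fun _ => hpos _) (fun _ => hrat _) (fun _ _ => hsub _ _)
    (fun _ _ => hadd _ _)
  let _ := hD.metricSpace
  have hne : ∀ x : {x : Option (Fin n) // x ≠ none}, ∃ i, x.1 = some i := fun x =>
    Option.ne_none_iff_exists'.1 x.2
  choose k hk using hne
  obtain ⟨ψ, hψ, h⟩ := hU.extension (Option (Fin n)) hD.rat none (fun x => a (e.symm (k x)))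
    (Isometry.of_dist_eq fun x y => by
      rw [Subtype.dist_eq, hk x, hk y]; rfl)
  refine ⟨ψ none, fun i => ?_⟩
  have h1 := h ⟨some (e i), by simp⟩
  have h2 := hk ⟨some (e i), by simp⟩
  have h3 : k ⟨some (e i), by simp⟩ = e i := (Option.some.inj h2).symm
  rw [h3, Equiv.symm_apply_apply] at h1
  rw [← h1, hψ.dist_eq]
  change f (e.symm (e i)) = f i
  rw [Equiv.symm_apply_apply]

/-- Where `a` repeats a value, `hsub` in both directions forces `f` to repeat too, so `f` descends
to the range of `a`. -/
theorem exists_dist_eq {I : Type*} [Finite I] (a : I → U)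
    {f : I → ℝ} (hpos : ∀ i, 0 < f i) (hrat : ∀ i, ∃ q : ℚ, f i = q)
    (hsub : ∀ i j, f i ≤ f j + dist (a j) (a i)) (hadd : ∀ i j, dist (a i) (a j) ≤ f i + f j) :
    ∃ u, ∀ i, dist u (a i) = f i := by
  have hc : ∀ x : Set.range a, ∃ i, a i = x := fun x => x.2
  choose c hc using hc
  obtain ⟨u, hu⟩ := hU.exists_dist_eq_of_injective (I := Set.range a) Subtype.val_injective
    (f := fun x => f (c x)) (fun _ => hpos _) (fun _ => hrat _)
    (fun x y => by rw [← hc x, ← hc y]; exact hsub _ _)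
    (fun x y => by rw [← hc x, ← hc y]; exact hadd _ _)
  refine ⟨u, fun i => ?_⟩
  have h1 := hu ⟨a i, i, rfl⟩
  have h2 := hc ⟨a i, i, rfl⟩
  have h3 := hsub (c ⟨a i, i, rfl⟩) i
  have h4 := hsub i (c ⟨a i, i, rfl⟩)
  rw [h2, dist_self, add_zero] at h3 h4
  rw [h1]
  exact le_antisymm h3 h4

/-- A partial embedding of a finite rational metric space into `U` extends. -/
theorem exists_extension {Z : Type*} [Finite Z] {D : Z → Z → ℝ} (hD : IsRationalMetric D)
    (s : Set Z) (φ : Z → U) (hφ : ∀ x ∈ s, ∀ y ∈ s, dist (φ x) (φ y) = D x y) :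
    ∃ ψ : Z → U, (∀ x ∈ s, ψ x = φ x) ∧ ∀ x y, dist (ψ x) (ψ y) = D x y := by
  classical
  -- The points of `t` are added one at a time, the distances `D z` from the next point `z` being
  -- the function to realise in `U`.
  have key : ∀ t : Set Z, t.Finite → ∃ ψ : Z → U, (∀ x ∈ s, ψ x = φ x) ∧
      ∀ x ∈ s ∪ t, ∀ y ∈ s ∪ t, dist (ψ x) (ψ y) = D x y := by
    intro t ht
    induction t, ht using Set.Finite.induction_on with
    | empty => exact ⟨φ, fun _ _ => rfl, by simpa using hφ⟩
    | @insert z t _ _ ih =>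
      obtain ⟨ψ, h1, h2⟩ := ih
      by_cases hz : z ∈ s ∪ t
      · have : s ∪ insert z t = s ∪ t := by
          rw [Set.union_insert, Set.insert_eq_of_mem hz]
        exact ⟨ψ, h1, by rwa [this]⟩
      obtain ⟨u, hu⟩ := hU.exists_dist_eq (I := {x // x ∈ s ∪ t}) (fun x => ψ x)
        (f := fun x => D z x) (fun x => hD.pos _ _ (fun h => hz (h ▸ x.2))) (fun x => hD.rat _ _)
        (fun x y => by rw [h2 _ y.2 _ x.2]; exact hD.tri _ _ _)
        (fun x y => by rw [h2 _ x.2 _ y.2, hD.symm z x]; exact hD.tri _ _ _)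
      have hne : ∀ x ∈ s ∪ t, x ≠ z := fun x hx h => hz (h ▸ hx)
      refine ⟨Function.update ψ z u, fun x hx => ?_, ?_⟩
      · rw [Function.update_of_ne (hne x (Or.inl hx)), h1 x hx]
      · rw [Set.union_insert]
        rintro x (rfl | hx) y (rfl | hy)
        · simp [hD.self]
        · rw [Function.update_self, Function.update_of_ne (hne y hy)]
          exact hu ⟨y, hy⟩
        · rw [Function.update_self, Function.update_of_ne (hne x hx), dist_comm, hD.symm]
          exact hu ⟨x, hx⟩
        · rw [Function.update_of_ne (hne x hx), Function.update_of_ne (hne y hy)]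
          exact h2 x hx y hy
  obtain ⟨ψ, h1, h2⟩ := key Set.univ Set.finite_univ
  exact ⟨ψ, h1, fun x y => h2 x (by simp) y (by simp)⟩

end IsRationalUrysohn

/-! ### Finite actions inside `U` -/

/-- An isometric action of `Γ` on a finite subset of `U`, recorded as an action on `U` that is
trivial outside the finite subset. -/
structure FinAction (Γ U : Type*) [Group Γ] [MetricSpace U] where
  carrier : Finset U
  act : Γ →* Equiv.Perm U
  mapsTo : ∀ g, ∀ x ∈ carrier, act g x ∈ carrier
  dist_act : ∀ g, ∀ x ∈ carrier, ∀ y ∈ carrier, dist (act g x) (act g y) = dist x y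
  fixed : ∀ g, ∀ x ∉ carrier, act g x = x

/-- A map that is equivariant under generators along an invariant set is equivariant there. -/
theorem MonoidHom.apply_map_eq_of_closure_eq_top {Γ X Y : Type*} [Group Γ] {S : Set Γ}
    (hS : Subgroup.closure S = ⊤) {α : Γ →* Equiv.Perm X} {β : Γ →* Equiv.Perm Y} {e : X → Y}
    {s : Set X} (hs : ∀ g, ∀ x ∈ s, α g x ∈ s) (h : ∀ g ∈ S, ∀ x ∈ s, β g (e x) = e (α g x))
    (g : Γ) : ∀ x ∈ s, β g (e x) = e (α g x) := by
  have hg : g ∈ Subgroup.closure S := hS ▸ Subgroup.mem_top g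
  induction hg using Subgroup.closure_induction with
  | mem g hg => exact h g hg
  | one => simp
  | mul a b _ _ iha ihb =>
    intro x hx
    rw [map_mul, map_mul, Equiv.Perm.mul_apply, Equiv.Perm.mul_apply, ihb x hx, iha _ (hs b x hx)]
  | inv a _ ih =>
    intro x hx
    have h1 := ih _ (hs a⁻¹ x hx)
    rw [map_inv β, Equiv.Perm.inv_eq_iff_eq, h1, map_inv, Equiv.Perm.inv_def,
      Equiv.apply_symm_apply]

namespace FinAction

variable {Γ U : Type*} [Group Γ] [MetricSpace U]

instance : Preorder (FinAction Γ U) where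
  le p q := p.carrier ⊆ q.carrier ∧ ∀ g, ∀ x ∈ p.carrier, q.act g x = p.act g x
  le_refl p := ⟨Finset.Subset.refl _, fun _ _ _ => rfl⟩
  le_trans p q r h1 h2 :=
    ⟨h1.1.trans h2.1, fun g x hx => (h2.2 g x (h1.1 hx)).trans (h1.2 g x hx)⟩

theorem act_inv_act (p : FinAction Γ U) (g : Γ) (x : U) : p.act g⁻¹ (p.act g x) = x := by
  rw [← Equiv.Perm.mul_apply, ← map_mul, inv_mul_cancel, map_one, Equiv.Perm.one_apply]

instance : Inhabited (FinAction Γ U) where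
  default := ⟨∅, 1, by simp, by simp, by simp⟩

/-- A finite action is trivial off its carrier and determined by generators, so the carrier and the
finite graphs of finitely many generators on it encode everything. -/
instance [Countable U] [Group.FG Γ] : Countable (FinAction Γ U) := by
  classical
  obtain ⟨S, hS⟩ := Group.fg_def.1 (inferInstance : Group.FG Γ)
  refine Function.Injective.countable
    (f := fun p : FinAction Γ U => (p.carrier, fun s : S => p.carrier.image fun x => (x, p.act s x)))
    ?_
  intro p q h
  obtain ⟨h1, h2⟩ := Prod.mk.inj h
  have key : ∀ g, ∀ x ∈ (p.carrier : Set U), q.act g x = p.act g x := by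
    refine MonoidHom.apply_map_eq_of_closure_eq_top (e := id) hS p.mapsTo fun g hg x hx => ?_
    have h3 := congrFun h2 ⟨g, hg⟩
    have h4 : (x, p.act g x) ∈ q.carrier.image fun x => (x, q.act g x) := by
      rw [← h3]
      exact Finset.mem_image_of_mem (fun x => (x, p.act g x)) hx
    obtain ⟨y, -, hy⟩ := Finset.mem_image.1 h4
    obtain ⟨rfl, h5⟩ := Prod.mk.inj hy
    exact h5
  have : p.act = q.act := by
    ext g x
    by_cases hx : x ∈ p.carrier
    · exact (key g x hx).symm
    · rw [p.fixed g x hx, q.fixed g x (h1 ▸ hx)]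
  cases p; cases q
  simp_all

/-- The action of `Γ` on the carrier. -/
def onCarrier (p : FinAction Γ U) : Γ →* Equiv.Perm p.carrier :=
  MonoidHom.toHomPerm
    { toFun := fun g x => ⟨p.act g x, p.mapsTo g x x.2⟩
      map_one' := funext fun x => Subtype.ext (by simp; rfl)
      map_mul' := fun a b => funext fun x => Subtype.ext (by simp; rfl) }

@[simp]
theorem coe_onCarrier (p : FinAction Γ U) (g : Γ) (x : p.carrier) :
    (p.onCarrier g x : U) = p.act g x := rfl

open Classical in
/-- Transport an isometric action along an injection into `U`. -/
noncomputable def ofEmbedding {Z : Type*} [Finite Z] (ρ : Γ →* Equiv.Perm Z) (ψ : Z ↪ U)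
    (h : ∀ g z z', dist (ψ (ρ g z)) (ψ (ρ g z')) = dist (ψ z) (ψ z')) : FinAction Γ U where
  carrier := (Set.finite_range ψ).toFinset
  act := (Equiv.Perm.viaEmbeddingHom ψ).comp ρ
  mapsTo := by
    intro g x hx
    obtain ⟨z, rfl⟩ := (Set.Finite.mem_toFinset _).1 hx
    simp [Equiv.Perm.viaEmbeddingHom_apply, Equiv.Perm.viaEmbedding_apply]
  dist_act := by
    intro g x hx y hy
    obtain ⟨z, rfl⟩ := (Set.Finite.mem_toFinset _).1 hx
    obtain ⟨z', rfl⟩ := (Set.Finite.mem_toFinset _).1 hy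
    simp [Equiv.Perm.viaEmbeddingHom_apply, Equiv.Perm.viaEmbedding_apply, h]
  fixed := by
    intro g x hx
    rw [Set.Finite.mem_toFinset] at hx
    simp [Equiv.Perm.viaEmbeddingHom_apply, Equiv.Perm.viaEmbedding_apply_of_notMem _ _ _ hx]

theorem mem_carrier_ofEmbedding {Z : Type*} [Finite Z] {ρ : Γ →* Equiv.Perm Z} {ψ : Z ↪ U}
    {h} {x : U} : x ∈ (ofEmbedding ρ ψ h).carrier ↔ ∃ z, ψ z = x := by
  simp [ofEmbedding]

theorem act_ofEmbedding {Z : Type*} [Finite Z] {ρ : Γ →* Equiv.Perm Z} {ψ : Z ↪ U}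
    {h} (g : Γ) (z : Z) : (ofEmbedding ρ ψ h).act g (ψ z) = ψ (ρ g z) := by
  simp [ofEmbedding, Equiv.Perm.viaEmbeddingHom_apply, Equiv.Perm.viaEmbedding_apply]

/-- A finite rational metric space with an isometric action, partially embedded in `U`, gives a
finite action inside `U`. -/
theorem exists_of_isRationalMetric (hU : IsRationalUrysohn U) {Z : Type*} [Finite Z]
    (ρ : Γ →* Equiv.Perm Z) {D : Z → Z → ℝ} (hD : IsRationalMetric D)
    (hρ : ∀ g z z', D (ρ g z) (ρ g z') = D z z') (s : Set Z) (φ : Z → U)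
    (hφ : ∀ x ∈ s, ∀ y ∈ s, dist (φ x) (φ y) = D x y) :
    ∃ (p : FinAction Γ U) (ψ : Z → U), (∀ x ∈ s, ψ x = φ x) ∧
      (∀ x y, dist (ψ x) (ψ y) = D x y) ∧ (∀ z, ψ z ∈ p.carrier) ∧
      ∀ g z, p.act g (ψ z) = ψ (ρ g z) := by
  obtain ⟨ψ, h1, h2⟩ := hU.exists_extension hD s φ hφ
  have hinj : Function.Injective ψ := by
    intro x y hxy
    by_contra hne
    have := hD.pos x y hne
    rw [← h2, hxy, dist_self] at this
    exact lt_irrefl _ this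
  exact ⟨ofEmbedding ρ ⟨ψ, hinj⟩ (fun g z z' => by
    change dist (ψ _) (ψ _) = dist (ψ _) (ψ _)
    rw [h2, h2, hρ]), ψ, h1, h2, fun z => mem_carrier_ofEmbedding.2 ⟨z, rfl⟩,
    fun g z => act_ofEmbedding (ψ := ⟨ψ, hinj⟩) g z⟩

/-- Glue a finite rational metric space `W` with an isometric action to a finite action, the
distances between the two parts being given by `m`. -/
theorem exists_glue (hU : IsRationalUrysohn U) (p : FinAction Γ U) {W : Type*} [Finite W]
    (ρ : Γ →* Equiv.Perm W) {D : W → W → ℝ} (hD : IsRationalMetric D)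
    (hρ : ∀ g w w', D (ρ g w) (ρ g w') = D w w') (m : p.carrier → W → ℝ)
    (hm : ∀ g y w, m (p.onCarrier g y) (ρ g w) = m y w)
    (mpos : ∀ y w, 0 < m y w) (mrat : ∀ y w, ∃ q : ℚ, m y w = q)
    (m1 : ∀ (y y' : p.carrier) w, m y w ≤ dist (y : U) y' + m y' w)
    (m2 : ∀ y w w', m y w ≤ m y w' + D w' w)
    (m3 : ∀ (y y' : p.carrier) w, dist (y : U) y' ≤ m y w + m y' w)
    (m4 : ∀ y w w', D w w' ≤ m y w + m y w')
    (s : Set W) (φ : W → U) (hφ : ∀ x ∈ s, ∀ y ∈ s, dist (φ x) (φ y) = D x y)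
    (hφ' : ∀ (y : p.carrier), ∀ w ∈ s, dist (y : U) (φ w) = m y w) :
    ∃ (q : FinAction Γ U) (ψ : W → U), p ≤ q ∧ (∀ w ∈ s, ψ w = φ w) ∧
      (∀ w w', dist (ψ w) (ψ w') = D w w') ∧ (∀ (y : p.carrier) w, dist (y : U) (ψ w) = m y w) ∧
      (∀ w, ψ w ∈ q.carrier) ∧ ∀ g w, q.act g (ψ w) = ψ (ρ g w) := by
  let E : p.carrier ⊕ W → p.carrier ⊕ W → ℝ := fun a b =>
    match a, b with
    | .inl y, .inl y' => dist (y : U) y'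
    | .inl y, .inr w => m y w
    | .inr w, .inl y => m y w
    | .inr w, .inr w' => D w w'
  have hE : IsRationalMetric E := by
    constructor
    · rintro (y | w)
      · exact dist_self _
      · exact hD.self w
    · rintro (y | w) (y' | w') h
      · exact dist_pos.2 fun h' => h (congrArg _ (Subtype.ext h'))
      · exact mpos _ _
      · exact mpos _ _
      · exact hD.pos _ _ fun h' => h (congrArg _ h')
    · rintro (y | w) (y' | w')
      · exact dist_comm _ _
      · rfl
      · rfl
      · exact hD.symm _ _
    · rintro (y | w) (y' | w') (y'' | w'')
      · exact dist_triangle _ _ _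
      · exact m1 _ _ _
      · exact m3 _ _ _
      · exact m2 _ _ _
      · change m y'' w ≤ m y' w + dist (y' : U) y''
        rw [add_comm, dist_comm]
        exact m1 _ _ _
      · exact m4 _ _ _
      · change m y'' w ≤ D w w' + m y'' w'
        rw [add_comm, hD.symm]
        exact m2 _ _ _
      · exact hD.tri _ _ _
    · rintro (y | w) (y' | w')
      · exact hU.rational _ _
      · exact mrat _ _
      · exact mrat _ _
      · exact hD.rat _ _
  let σ : Γ →* Equiv.Perm (p.carrier ⊕ W) :=
    (Equiv.Perm.sumCongrHom p.carrier W).comp (p.onCarrier.prod ρ)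
  obtain ⟨q, ψ, h1, h2, h3, h4⟩ := exists_of_isRationalMetric hU σ hE (by
      rintro g (y | w) (y' | w')
      · exact p.dist_act g y y.2 y' y'.2
      · exact hm _ _ _
      · exact hm _ _ _
      · exact hρ _ _ _)
    (Set.range Sum.inl ∪ Sum.inr '' s) (Sum.elim (fun y => (y : U)) φ) (by
      rintro _ (⟨y, rfl⟩ | ⟨w, hw, rfl⟩) _ (⟨y', rfl⟩ | ⟨w', hw', rfl⟩)
      · rfl
      · exact hφ' _ _ hw'
      · exact (dist_comm _ _).trans (hφ' _ _ hw)
      · exact hφ _ hw _ hw')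
  have h5 : ∀ y : p.carrier, ψ (.inl y) = y := fun y => h1 _ (Or.inl ⟨y, rfl⟩)
  refine ⟨q, fun w => ψ (.inr w), ⟨?_, ?_⟩, fun w hw => h1 _ (Or.inr ⟨w, hw, rfl⟩),
    fun w w' => h2 _ _, fun y w => ?_, fun w => h3 _, fun g w => h4 g _⟩
  · intro y hy
    have h6 := h3 (.inl ⟨y, hy⟩)
    rwa [h5] at h6
  · intro g y hy
    have h6 := h4 g (.inl ⟨y, hy⟩)
    rw [h5] at h6
    exact h6.trans (h5 (p.onCarrier g ⟨y, hy⟩))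
  · rw [← h5 y, h2]

/-- The sup distance of two finite families of rationals is rational. -/
theorem _root_.exists_rat_eq_dist_pi {ι : Type*} [Fintype ι] {f g : ι → ℝ}
    (hf : ∀ i, ∃ q : ℚ, f i = q) (hg : ∀ i, ∃ q : ℚ, g i = q) : ∃ q : ℚ, dist f g = q := by
  rcases isEmpty_or_nonempty ι with h | h
  · exact ⟨0, by simp [Subsingleton.elim f g]⟩
  obtain ⟨i, -, hi⟩ := Finset.exists_mem_eq_sup Finset.univ Finset.univ_nonempty
    fun i => nndist (f i) (g i)
  obtain ⟨a, ha⟩ := hf i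
  obtain ⟨b, hb⟩ := hg i
  refine ⟨|a - b|, ?_⟩
  rw [dist_pi_def, hi, coe_nndist, Real.dist_eq, ha, hb]
  push_cast
  rfl

/-- Every point can be added to a finite action. -/
theorem exists_mem_carrier (hU : IsRationalUrysohn U) (p : FinAction Γ U) (x : U) :
    ∃ q, p ≤ q ∧ x ∈ q.carrier := by
  by_cases hx : x ∈ p.carrier
  · exact ⟨p, le_rfl, hx⟩
  -- The new points are the distance functions to `x` twisted by all self-isometries of the carrier:
  -- a finite set, stable under `Γ`, containing the distance function of `x` itself. Their mutual
  -- distance is the sup distance, as in Katětov's construction.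
  let W : Set (p.carrier → ℝ) := Set.range fun σ : {σ : Equiv.Perm p.carrier //
    ∀ y y', dist (σ y : U) (σ y') = dist (y : U) y'} => fun y => dist (σ.1 y : U) x
  have hWpos : ∀ f ∈ W, ∀ y, 0 < f y := by
    rintro _ ⟨σ, rfl⟩ y
    exact dist_pos.2 fun h => hx (h ▸ (σ.1 y).2)
  have hWrat : ∀ f ∈ W, ∀ y, ∃ q : ℚ, f y = q := by
    rintro _ ⟨σ, rfl⟩ y
    exact hU.rational _ _
  have hW1 : ∀ f ∈ W, ∀ y y' : p.carrier, f y ≤ dist (y : U) y' + f y' := by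
    rintro _ ⟨σ, rfl⟩ y y'
    rw [← σ.2]
    exact dist_triangle _ _ _
  have hW2 : ∀ f ∈ W, ∀ y y' : p.carrier, dist (y : U) y' ≤ f y + f y' := by
    rintro _ ⟨σ, rfl⟩ y y'
    rw [← σ.2]
    exact dist_triangle_right _ _ _
  have hWact : ∀ g, ∀ f ∈ W, f ∘ p.onCarrier g ∈ W := by
    rintro g _ ⟨σ, rfl⟩
    refine ⟨⟨σ.1 * p.onCarrier g, fun y y' => ?_⟩, rfl⟩
    rw [Equiv.Perm.mul_apply, Equiv.Perm.mul_apply, σ.2]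
    exact p.dist_act g y y.2 y' y'.2
  let ρ : Γ →* Equiv.Perm W := MonoidHom.toHomPerm
    { toFun := fun g f => ⟨f.1 ∘ p.onCarrier g⁻¹, hWact _ _ f.2⟩
      map_one' := funext fun f => Subtype.ext (by simp; rfl)
      map_mul' := fun a b => funext fun f => Subtype.ext (by simp; rfl) }
  have hρ : ∀ g (f : W), ((ρ g f : W) : p.carrier → ℝ) = f.1 ∘ p.onCarrier g⁻¹ := fun _ _ => rfl
  let f₀ : W := ⟨fun y => dist (y : U) x, ⟨1, fun _ _ => rfl⟩, rfl⟩
  obtain ⟨q, ψ, h1, h2, -, -, h3, -⟩ := p.exists_glue hU ρ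
    (D := fun f f' : W => dist (f : p.carrier → ℝ) f')
    ⟨fun f => dist_self _, fun f f' h => dist_pos.2 fun h' => h (Subtype.ext h'),
      fun _ _ => dist_comm _ _, fun _ _ _ => dist_triangle _ _ _,
      fun f f' => exists_rat_eq_dist_pi (hWrat f f.2) (hWrat f' f'.2)⟩
    (by
      have hle : ∀ g (f f' : W), dist (ρ g f : p.carrier → ℝ) (ρ g f') ≤
          dist (f : p.carrier → ℝ) f' := fun g f f' =>
        (dist_pi_le_iff dist_nonneg).2 fun y => dist_le_pi_dist f.1 f'.1 _
      intro g f f'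
      refine le_antisymm (hle g f f') ?_
      have := hle g⁻¹ (ρ g f) (ρ g f')
      rwa [← Equiv.Perm.mul_apply, ← Equiv.Perm.mul_apply, ← map_mul, inv_mul_cancel, map_one,
        Equiv.Perm.one_apply, Equiv.Perm.one_apply] at this)
    (fun y f => f.1 y)
    (by
      intro g y f
      rw [hρ, Function.comp_apply, ← Equiv.Perm.mul_apply, ← map_mul, inv_mul_cancel, map_one,
        Equiv.Perm.one_apply])
    (fun y f => hWpos f f.2 y) (fun y f => hWrat f f.2 y) (fun y y' f => hW1 f f.2 y y')
    (by
      intro y f f'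
      have := dist_le_pi_dist f.1 f'.1 y
      rw [Real.dist_eq] at this
      rw [dist_comm]
      linarith [le_abs_self (f.1 y - f'.1 y)])
    (fun y y' f => hW2 f f.2 y y')
    (by
      intro y f f'
      refine (dist_pi_le_iff (add_pos (hWpos f f.2 y) (hWpos f' f'.2 y)).le).2 fun z => ?_
      rw [Real.dist_eq, abs_le]
      constructor
      · linarith [hW1 f' f'.2 z y, hW2 f f.2 z y]
      · linarith [hW1 f f.2 z y, hW2 f' f'.2 z y])
    {f₀} (fun _ => x) (by simp) (by rintro y _ rfl; rfl)
  refine ⟨q, h1, ?_⟩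
  have := h3 f₀
  rwa [h2 f₀ rfl] at this

theorem exists_subset_carrier (hU : IsRationalUrysohn U) (p : FinAction Γ U) (A : Finset U) :
    ∃ q, p ≤ q ∧ A ⊆ q.carrier := by
  classical
  induction A using Finset.induction_on with
  | empty => exact ⟨p, le_rfl, by simp⟩
  | insert x A _ ih =>
    obtain ⟨q, h1, h2⟩ := ih
    obtain ⟨r, h3, h4⟩ := q.exists_mem_carrier hU x
    exact ⟨r, h1.trans h3, Finset.insert_subset h4 (h2.trans h3.1)⟩

end FinAction

/-! ### Free amalgams and rich representations -/

/-- The distance between `y` and `w` through a point of `A`, capped by `C`. -/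
noncomputable def bridgeDist {U : Type*} [MetricSpace U] (A : Finset U) (C : ℝ) (y w : U) : ℝ :=
  (Finset.univ : Finset (Option A)).inf' ⟨none, Finset.mem_univ _⟩
    fun o => o.elim C fun a => dist y a + dist (a : U) w

section bridgeDist

variable {U : Type*} [MetricSpace U] {A : Finset U} {C : ℝ} {y w : U}

theorem bridgeDist_le_const : bridgeDist A C y w ≤ C :=
  Finset.inf'_le (s := Finset.univ) (fun o : Option A => o.elim C fun a => dist y a + dist (a : U) w)
    (Finset.mem_univ none)

theorem bridgeDist_le {a : U} (ha : a ∈ A) : bridgeDist A C y w ≤ dist y a + dist a w :=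
  Finset.inf'_le (s := Finset.univ) (fun o : Option A => o.elim C fun a => dist y a + dist (a : U) w)
    (Finset.mem_univ (some (⟨a, ha⟩ : A)))

theorem bridgeDist_eq :
    bridgeDist A C y w = C ∨ ∃ a ∈ A, bridgeDist A C y w = dist y a + dist a w := by
  obtain ⟨o, -, ho⟩ := Finset.exists_mem_eq_inf' ⟨none, Finset.mem_univ _⟩
    fun o : Option A => o.elim C fun a => dist y a + dist (a : U) w
  rcases o with _ | a
  · exact Or.inl ho
  · exact Or.inr ⟨a, a.2, ho⟩

theorem le_bridgeDist {r : ℝ} (hC : r ≤ C) (h : ∀ a ∈ A, r ≤ dist y a + dist a w) :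
    r ≤ bridgeDist A C y w := by
  rcases bridgeDist_eq (A := A) (C := C) (y := y) (w := w) with h1 | ⟨a, ha, h1⟩
  · rwa [h1]
  · rw [h1]; exact h a ha

end bridgeDist

namespace FinAction

variable {Γ U : Type*} [Group Γ] [MetricSpace U]

/-- Two finite actions that agree on a common invariant subset have an amalgam over it. -/
theorem exists_amalgam (hU : IsRationalUrysohn U) (p q : FinAction Γ U) {A : Finset U}
    (hp : A ⊆ p.carrier) (hq : A ⊆ q.carrier) (hA : ∀ g, ∀ a ∈ A, q.act g a ∈ A)
    (hpq : ∀ g, ∀ a ∈ A, p.act g a = q.act g a) :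
    ∃ (r : FinAction Γ U) (ψ : U → U), p ≤ r ∧ (∀ a ∈ A, ψ a = a) ∧
      (∀ b ∈ q.carrier, ∀ b' ∈ q.carrier, dist (ψ b) (ψ b') = dist b b') ∧
      (∀ b ∈ q.carrier, ψ b ∈ r.carrier) ∧
      ∀ g, ∀ b ∈ q.carrier, r.act g (ψ b) = ψ (q.act g b) := by
  classical
  -- The cap must dominate both diameters for the triangle inequalities. It must also be positive,
  -- since `A` may be empty and then every bridge has length `C`.
  obtain ⟨C, hC0, hC⟩ : ∃ C : ℕ, 0 < C ∧
      ∀ x ∈ p.carrier ∪ q.carrier, ∀ y ∈ p.carrier ∪ q.carrier, dist x y ≤ C := by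
    obtain ⟨M, hM⟩ := (((p.carrier ∪ q.carrier) ×ˢ (p.carrier ∪ q.carrier)).image
      fun z => dist z.1 z.2).exists_le
    obtain ⟨n, hn⟩ := exists_nat_ge M
    refine ⟨n + 1, n.succ_pos, fun x hx y hy => ?_⟩
    have := hM _ (Finset.mem_image_of_mem (fun z : U × U => dist z.1 z.2)
      (Finset.mk_mem_product hx hy))
    push_cast
    dsimp only at this
    linarith
  have hCp : ∀ x ∈ p.carrier, ∀ y ∈ p.carrier, dist x y ≤ C := fun x hx y hy =>
    hC x (Finset.mem_union_left _ hx) y (Finset.mem_union_left _ hy)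
  have hCq : ∀ x ∈ q.carrier, ∀ y ∈ q.carrier, dist x y ≤ C := fun x hx y hy =>
    hC x (Finset.mem_union_right _ hx) y (Finset.mem_union_right _ hy)
  have hA' : ∀ g a, q.act g a ∈ A ↔ a ∈ A := fun g a =>
    ⟨fun h => by simpa [q.act_inv_act] using hA g⁻¹ _ h, hA g a⟩
  let W := {b // b ∈ q.carrier ∧ b ∉ A}
  have : Finite W := Finite.of_injective (fun w : W => (⟨w.1, w.2.1⟩ : q.carrier))
    fun w w' h => Subtype.ext (congrArg Subtype.val h :)
  let ρ : Γ →* Equiv.Perm W := MonoidHom.toHomPerm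
    { toFun := fun g w => ⟨q.act g w, q.mapsTo g w w.2.1, fun h => w.2.2 ((hA' g w).1 h)⟩
      map_one' := funext fun f => Subtype.ext (by simp; rfl)
      map_mul' := fun a b => funext fun f => Subtype.ext (by simp; rfl) }
  have hρ : ∀ g (w : W), (ρ g w : U) = q.act g w := fun _ _ => rfl
  have hm : ∀ g (y : p.carrier) (w : W),
      bridgeDist A C (p.onCarrier g y) (ρ g w) ≤ bridgeDist A C y w := by
    intro g y w
    refine le_bridgeDist bridgeDist_le_const fun a ha => ?_
    refine (bridgeDist_le (hA g a ha)).trans_eq ?_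
    rw [p.coe_onCarrier, hρ, q.dist_act g a (hq ha) w w.2.1, ← hpq g a ha,
      p.dist_act g y y.2 a (hp ha)]
  obtain ⟨r, ψ, h1, -, h2, h3, h4, h5⟩ := p.exists_glue hU ρ
    (D := fun w w' : W => dist (w : U) w')
    (isRationalMetric_dist hU.rational Subtype.val_injective)
    (fun g w w' => q.dist_act g w w.2.1 w' w'.2.1) (fun y w => bridgeDist A C y w)
    (by
      intro g y w
      refine le_antisymm (hm g y w) ?_
      have := hm g⁻¹ (p.onCarrier g y) (ρ g w)
      rwa [← Equiv.Perm.mul_apply, ← Equiv.Perm.mul_apply, ← map_mul, ← map_mul, inv_mul_cancel,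
        map_one, map_one, Equiv.Perm.one_apply, Equiv.Perm.one_apply] at this)
    (by
      intro y w
      rcases bridgeDist_eq (A := A) (C := C) (y := y) (w := w) with h | ⟨a, ha, h⟩
      · rw [h]; exact_mod_cast hC0
      · rw [h]
        have : 0 < dist a (w : U) := dist_pos.2 fun h => w.2.2 (h ▸ ha)
        have : 0 ≤ dist (y : U) a := dist_nonneg
        linarith)
    (by
      intro y w
      rcases bridgeDist_eq (A := A) (C := C) (y := y) (w := w) with h | ⟨a, ha, h⟩
      · exact ⟨C, by rw [h]; simp⟩
      · obtain ⟨s, hs⟩ := hU.rational y a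
        obtain ⟨t, ht⟩ := hU.rational a w
        exact ⟨s + t, by rw [h, hs, ht]; push_cast; rfl⟩)
    (by
      intro y y' w
      rw [← sub_le_iff_le_add']
      refine le_bridgeDist ?_ fun a ha => ?_
      · have := bridgeDist_le_const (A := A) (C := C) (y := y) (w := w)
        linarith [dist_nonneg (x := (y : U)) (y := y')]
      · have := bridgeDist_le (C := C) (y := (y : U)) (w := (w : U)) ha
        linarith [dist_triangle (y : U) y' a])
    (by
      intro y w w'
      rw [← sub_le_iff_le_add]
      refine le_bridgeDist ?_ fun a ha => ?_
      · have := bridgeDist_le_const (A := A) (C := C) (y := y) (w := w)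
        linarith [dist_nonneg (x := (w' : U)) (y := w)]
      · have := bridgeDist_le (C := C) (y := (y : U)) (w := (w : U)) ha
        linarith [dist_triangle a (w' : U) w])
    (by
      intro y y' w
      have h0 : ∀ z : p.carrier, 0 ≤ bridgeDist A C z w := fun z =>
        le_bridgeDist (Nat.cast_nonneg _) fun _ _ => add_nonneg dist_nonneg dist_nonneg
      rcases bridgeDist_eq (A := A) (C := C) (y := y) (w := w) with h | ⟨a, ha, h⟩
      · linarith [hCp y y.2 y' y'.2, h0 y']
      rcases bridgeDist_eq (A := A) (C := C) (y := y') (w := w) with h' | ⟨a', ha', h'⟩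
      · linarith [hCp y y.2 y' y'.2, h0 y]
      rw [h, h']
      linarith [dist_triangle4_right (y : U) y' a a', dist_triangle_right a a' (w : U)])
    (by
      intro y w w'
      have h0 : ∀ z : W, 0 ≤ bridgeDist A C y z := fun z =>
        le_bridgeDist (Nat.cast_nonneg _) fun _ _ => add_nonneg dist_nonneg dist_nonneg
      rcases bridgeDist_eq (A := A) (C := C) (y := y) (w := w) with h | ⟨a, ha, h⟩
      · linarith [hCq w w.2.1 w' w'.2.1, h0 w']
      rcases bridgeDist_eq (A := A) (C := C) (y := y) (w := w') with h' | ⟨a', ha', h'⟩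
      · linarith [hCq w w.2.1 w' w'.2.1, h0 w]
      rw [h, h']
      linarith [dist_triangle (w : U) a w', dist_triangle a y (w' : U),
        dist_triangle (y : U) a' w', dist_comm (w : U) a, dist_comm a (y : U)])
    ∅ (fun w => w) (by simp) (by simp)
  have hne : ∀ b ∈ q.carrier, b ∉ A → b ∈ q.carrier ∧ b ∉ A := fun b h h' => ⟨h, h'⟩
  -- From a point of `A` the cheapest bridge starts at that point itself, so the original distances
  -- between `A` and the rest of `q.carrier` survive.
  have key : ∀ a ∈ A, ∀ b, ∀ (hb : b ∈ q.carrier ∧ b ∉ A), dist a (ψ ⟨b, hb⟩) = dist a b := by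
    intro a ha b hb
    rw [h3 ⟨a, hp ha⟩]
    refine le_antisymm ((bridgeDist_le ha).trans_eq (by simp))
      (le_bridgeDist (hCq a (hq ha) b hb.1) fun _ _ => dist_triangle _ _ _)
  refine ⟨r, fun b => if h : b ∈ q.carrier ∧ b ∉ A then ψ ⟨b, h⟩ else b, h1,
    fun a ha => dif_neg fun h => h.2 ha, fun b hb b' hb' => ?_, fun b hb => ?_, fun g b hb => ?_⟩
  · by_cases h : b ∈ A <;> by_cases h' : b' ∈ A
    · simp [h, h']
    · simp only [h, h', hb', not_true, and_false, dite_false, not_false_iff, and_true, dite_true]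
      exact key b h b' _
    · simp only [h, h', hb, not_true, and_false, dite_false, not_false_iff, and_true, dite_true]
      rw [dist_comm, dist_comm b]
      exact key b' h' b _
    · simp only [h, h', hb, hb', not_false_iff, and_true, dite_true]
      exact h2 _ _
  · dsimp only
    split_ifs with h
    · exact h4 _
    · exact h1.1 (hp (by tauto))
  · by_cases h : b ∈ A
    · have h' := hA g b h
      simp only [h, h', not_true, and_false, dite_false]
      rw [h1.2 g b (hp h), hpq g b h]
    · have h' : q.act g b ∉ A := fun h' => h ((hA' g b).1 h')
      simp only [h, h', hb, q.mapsTo g b hb, not_false_iff, and_true, dite_true]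
      exact h5 g ⟨b, hb, h⟩

end FinAction

/-- A representation with finite orbits that realises all finite extensions of its finite
subactions. -/
structure IsRich {Γ U : Type*} [Group Γ] [MetricSpace U] (π : Γ →* (U ≃ᵢ U)) : Prop where
  finite_orbit : ∀ x : U, (Set.range fun g : Γ => π g x).Finite
  exists_embedding : ∀ (q : FinAction Γ U) (A : Finset U), A ⊆ q.carrier →
    (∀ g, ∀ a ∈ A, q.act g a ∈ A) → (∀ g, ∀ a ∈ A, π g a = q.act g a) →
    ∃ ψ : U → U, (∀ a ∈ A, ψ a = a) ∧
      (∀ b ∈ q.carrier, ∀ b' ∈ q.carrier, dist (ψ b) (ψ b') = dist b b') ∧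
      ∀ g, ∀ b ∈ q.carrier, π g (ψ b) = ψ (q.act g b)

namespace FinAction

variable {Γ U : Type*} [Group Γ] [MetricSpace U]

/-- A directed family of finite actions that exhausts `U` has a union. -/
theorem exists_representation (I : Order.Ideal (FinAction Γ U))
    (hI : ∀ x : U, ∃ p ∈ I, x ∈ p.carrier) :
    ∃ π : Γ →* (U ≃ᵢ U), ∀ p ∈ I, ∀ g, ∀ x ∈ p.carrier, π g x = p.act g x := by
  choose c hc hxc using hI
  have key : ∀ p ∈ I, ∀ g, ∀ x ∈ p.carrier, (c x).act g x = p.act g x := by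
    intro p hp g x hx
    obtain ⟨r, -, h1, h2⟩ := I.directed p hp (c x) (hc x)
    rw [← h1.2 g x hx, ← h2.2 g x (hxc x)]
  have hmul : ∀ a b x, (c x).act (a * b) x = (c ((c x).act b x)).act a ((c x).act b x) := by
    intro a b x
    rw [key (c x) (hc x) a _ ((c x).mapsTo b x (hxc x)), map_mul, Equiv.Perm.mul_apply]
  let T : Γ → U ≃ᵢ U := fun g => IsometryEquiv.mk
    ⟨fun x => (c x).act g x, fun x => (c x).act g⁻¹ x,
      fun x => by dsimp only; rw [← hmul, inv_mul_cancel, map_one, Equiv.Perm.one_apply],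
      fun x => by dsimp only; rw [← hmul, mul_inv_cancel, map_one, Equiv.Perm.one_apply]⟩
    (Isometry.of_dist_eq fun x y => by
      obtain ⟨r, hr, h1, h2⟩ := I.directed (c x) (hc x) (c y) (hc y)
      change dist ((c x).act g x) ((c y).act g y) = dist x y
      rw [key r hr g x (h1.1 (hxc x)), key r hr g y (h2.1 (hxc y)),
        r.dist_act g x (h1.1 (hxc x)) y (h2.1 (hxc y))])
  refine ⟨⟨⟨T, ?_⟩, ?_⟩, fun p hp g x hx => key p hp g x hx⟩
  · ext x
    change (c x).act 1 x = x
    rw [map_one, Equiv.Perm.one_apply]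
  · intro a b
    ext x
    exact hmul a b x

/-- Every finite action extends to a rich representation. -/
theorem exists_isRich (hU : IsRationalUrysohn U) [Group.FG Γ] (p : FinAction Γ U) :
    ∃ π : Γ →* (U ≃ᵢ U), IsRich π ∧ ∀ g, ∀ x ∈ p.carrier, π g x = p.act g x := by
  have := hU.countable
  let _ := Encodable.ofCountable (U ⊕ FinAction Γ U × Finset U)
  let realises (q : FinAction Γ U) (A : Finset U) (r : FinAction Γ U) : Prop :=
    A ⊆ q.carrier → (∀ g, ∀ a ∈ A, q.act g a ∈ A) → (∀ g, ∀ a ∈ A, r.act g a = q.act g a) →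
      ∃ ψ : U → U, (∀ a ∈ A, ψ a = a) ∧
        (∀ b ∈ q.carrier, ∀ b' ∈ q.carrier, dist (ψ b) (ψ b') = dist b b') ∧
        (∀ b ∈ q.carrier, ψ b ∈ r.carrier) ∧ ∀ g, ∀ b ∈ q.carrier, r.act g (ψ b) = ψ (q.act g b)
  -- Once `A ⊆ r.carrier`, the action `r` decides whether the final representation agrees with `q`
  -- on `A`. If it agrees, an amalgam realises `q`; if not, the requirement is void.
  have hcof : ∀ q A, IsCofinal {r : FinAction Γ U | A ⊆ r.carrier ∧ realises q A r} := by
    intro q A p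
    obtain ⟨r, h1, h2⟩ := p.exists_subset_carrier hU A
    by_cases h : A ⊆ q.carrier ∧ (∀ g, ∀ a ∈ A, q.act g a ∈ A) ∧
        ∀ g, ∀ a ∈ A, r.act g a = q.act g a
    · obtain ⟨s, ψ, h3, h4⟩ := exists_amalgam hU r q h2 h.1 h.2.1 h.2.2
      exact ⟨s, ⟨h2.trans h3.1, fun _ _ _ => ⟨ψ, h4⟩⟩, h1.trans h3⟩
    · exact ⟨r, ⟨h2, fun a b c => absurd ⟨a, b, c⟩ h⟩, h1⟩
  let 𝒟 : U ⊕ FinAction Γ U × Finset U → Order.Cofinal (FinAction Γ U)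
    | .inl x => ⟨{r | x ∈ r.carrier}, fun p => by
        obtain ⟨q, h1, h2⟩ := p.exists_mem_carrier hU x
        exact ⟨q, h2, h1⟩⟩
    | .inr a => ⟨_, hcof a.1 a.2⟩
  have hI : ∀ x : U, ∃ r ∈ Order.idealOfCofinals p 𝒟, x ∈ r.carrier := by
    intro x
    obtain ⟨r, h1, h2⟩ := Order.cofinal_meets_idealOfCofinals p 𝒟 (.inl x)
    exact ⟨r, h2, h1⟩
  obtain ⟨π, hπ⟩ := exists_representation _ hI
  refine ⟨π, ⟨fun x => ?_, fun q A h1 h2 h3 => ?_⟩, hπ p (Order.mem_idealOfCofinals p 𝒟)⟩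
  · obtain ⟨r, hr, hx⟩ := hI x
    refine r.carrier.finite_toSet.subset ?_
    rintro _ ⟨g, rfl⟩
    dsimp only
    rw [hπ r hr g x hx]
    exact r.mapsTo g x hx
  · obtain ⟨r, ⟨h4, h5⟩, hr⟩ := Order.cofinal_meets_idealOfCofinals p 𝒟 (.inr (q, A))
    obtain ⟨ψ, h6, h7, h8, h9⟩ := h5 h1 h2 fun g a ha => by rw [← hπ r hr g a (h4 ha), h3 g a ha]
    exact ⟨ψ, h6, h7, fun g b hb => by rw [hπ r hr g _ (h8 b hb), h9 g b hb]⟩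

end FinAction

/-! ### Conjugacy of rich representations -/

/-- Finite partial isometries of `U` that intertwine `π` and `θ`. -/
def PartialConj {Γ U : Type*} [Group Γ] [MetricSpace U] (π θ : Γ →* (U ≃ᵢ U)) : Type _ :=
  {f : Finset (U × U) // (∀ z ∈ f, ∀ w ∈ f, dist z.1 w.1 = dist z.2 w.2) ∧
    ∀ g, ∀ z ∈ f, (π g z.1, θ g z.2) ∈ f}

namespace PartialConj

variable {Γ U : Type*} [Group Γ] [MetricSpace U] {π θ : Γ →* (U ≃ᵢ U)}

instance : Preorder (PartialConj π θ) := inferInstanceAs (Preorder (Subtype _))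

theorem eq_of_mem (f : PartialConj π θ) {x y y' : U} (h : (x, y) ∈ f.1) (h' : (x, y') ∈ f.1) :
    y = y' := by
  have := f.2.1 _ h _ h'
  rw [dist_self] at this
  exact dist_eq_zero.1 this.symm

open Classical in
/-- The inverse of a partial conjugation. -/
noncomputable def symm (f : PartialConj π θ) : PartialConj θ π :=
  ⟨f.1.image Prod.swap, by
    constructor
    · intro z hz w hw
      obtain ⟨z', hz', rfl⟩ := Finset.mem_image.1 hz
      obtain ⟨w', hw', rfl⟩ := Finset.mem_image.1 hw
      exact (f.2.1 z' hz' w' hw').symm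
    · intro g z hz
      obtain ⟨z', hz', rfl⟩ := Finset.mem_image.1 hz
      exact Finset.mem_image.2 ⟨_, f.2.2 g z' hz', rfl⟩⟩

theorem mem_symm {f : PartialConj π θ} {x y : U} : (x, y) ∈ f.symm.1 ↔ (y, x) ∈ f.1 := by
  classical
  simp [symm]

/-- The domain of a partial conjugation can be enlarged by any point. -/
theorem exists_mem_dom (hU : IsRationalUrysohn U)
    (hπ : ∀ x : U, (Set.range fun g : Γ => π g x).Finite) (hθ : IsRich θ)
    (f : PartialConj π θ) (x : U) : ∃ f' : PartialConj π θ, f ≤ f' ∧ ∃ y, (x, y) ∈ f'.1 := by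
  classical
  -- The domain of `f` together with the orbit of `x`: a finite set invariant under `π`.
  let Z := {z : U // (∃ y, (z, y) ∈ f.1) ∨ z ∈ Set.range fun g : Γ => π g x}
  have : Finite Z := by
    refine Set.Finite.to_subtype (s := {z | (∃ y, (z, y) ∈ f.1) ∨ z ∈ Set.range fun g : Γ => π g x})
      (Set.Finite.union ((f.1.finite_toSet.image Prod.fst).subset ?_) (hπ x))
    rintro z ⟨y, hy⟩
    exact ⟨_, hy, rfl⟩
  have hmul : ∀ a b z, π (a * b) z = π a (π b z) := fun a b z => by rw [map_mul]; rfl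
  let ρ : Γ →* Equiv.Perm Z := MonoidHom.toHomPerm
    { toFun := fun g z => ⟨π g z, z.2.imp (fun ⟨y, hy⟩ => ⟨_, f.2.2 g _ hy⟩)
        fun ⟨h, hh⟩ => ⟨g * h, by dsimp only at hh ⊢; rw [hmul, hh]⟩⟩
      map_one' := funext fun z => Subtype.ext (by simp; rfl)
      map_mul' := fun a b => funext fun z => Subtype.ext (by simp; rfl) }
  let φ : Z → U := fun z => if h : ∃ y, (z.1, y) ∈ f.1 then h.choose else z
  have hφ : ∀ z : Z, ∀ y, (z.1, y) ∈ f.1 → φ z = y := by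
    intro z y hy
    have h : ∃ y, (z.1, y) ∈ f.1 := ⟨y, hy⟩
    simp only [φ, dif_pos h]
    exact f.eq_of_mem h.choose_spec hy
  obtain ⟨q, j, h1, h2, h3, h4⟩ := FinAction.exists_of_isRationalMetric hU ρ
    (isRationalMetric_dist hU.rational (Subtype.val_injective (p := fun z : U =>
      (∃ y, (z, y) ∈ f.1) ∨ z ∈ Set.range fun g : Γ => π g x)))
    (fun g z z' => (π g).dist_eq z z') {z | ∃ y, (z.1, y) ∈ f.1} φ
    (by
      rintro z ⟨y, hy⟩ z' ⟨y', hy'⟩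
      rw [hφ z y hy, hφ z' y' hy']
      exact (f.2.1 _ hy _ hy').symm)
  have hj : ∀ z y, ∀ h : (z, y) ∈ f.1, j ⟨z, Or.inl ⟨y, h⟩⟩ = y := fun z y h =>
    (h1 _ ⟨y, h⟩).trans (hφ _ y h)
  have hact : ∀ g z y, (z, y) ∈ f.1 → q.act g y = θ g y := by
    intro g z y h
    have h5 := h4 g ⟨z, Or.inl ⟨y, h⟩⟩
    rw [hj z y h] at h5
    rw [h5]
    exact hj _ _ (f.2.2 g _ h)
  -- `q` is a copy of the action on `Z` that agrees with `θ` on the range of `f`. Richness of `θ`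
  -- moves it onto a subaction of `θ` while fixing that range.
  obtain ⟨ψ, h5, h6, h7⟩ := hθ.exists_embedding q (f.1.image Prod.snd)
    (by
      intro y hy
      obtain ⟨⟨z, y⟩, h, rfl⟩ := Finset.mem_image.1 hy
      have := h3 ⟨z, Or.inl ⟨y, h⟩⟩
      rwa [hj z y h] at this)
    (by
      intro g y hy
      obtain ⟨⟨z, y⟩, h, rfl⟩ := Finset.mem_image.1 hy
      rw [hact g z y h]
      exact Finset.mem_image.2 ⟨_, f.2.2 g _ h, rfl⟩)
    (by
      intro g y hy
      obtain ⟨⟨z, y⟩, h, rfl⟩ := Finset.mem_image.1 hy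
      exact (hact g z y h).symm)
  have hfin := Set.finite_range fun z : Z => (z.1, ψ (j z))
  refine ⟨⟨hfin.toFinset, ?_, ?_⟩, ?_, ψ (j ⟨x, Or.inr ⟨1, by simp⟩⟩), ?_⟩
  · intro z hz w hw
    obtain ⟨z, rfl⟩ := (Set.Finite.mem_toFinset _).1 hz
    obtain ⟨w, rfl⟩ := (Set.Finite.mem_toFinset _).1 hw
    dsimp only
    rw [h6 _ (h3 z) _ (h3 w), h2]
  · intro g z hz
    obtain ⟨z, rfl⟩ := (Set.Finite.mem_toFinset _).1 hz
    refine (Set.Finite.mem_toFinset _).2 ⟨ρ g z, ?_⟩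
    dsimp only
    rw [h7 g _ (h3 z), h4]
    rfl
  · rintro ⟨z, y⟩ h
    refine (Set.Finite.mem_toFinset _).2 ⟨⟨z, Or.inl ⟨y, h⟩⟩, ?_⟩
    dsimp only
    rw [hj z y h, h5 y (Finset.mem_image.2 ⟨_, h, rfl⟩)]
  · exact (Set.Finite.mem_toFinset _).2 ⟨⟨x, Or.inr ⟨1, by simp⟩⟩, rfl⟩

end PartialConj

/-- Back-and-forth: each step needs finite orbits on the side of the new point and richness on the
other. An ideal of partial conjugations meeting the countably many domain and range conditions has
as its union the graph of a conjugating isometry. -/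
theorem IsRich.mem_conjOrbit {Γ U : Type*} [Group Γ] [MetricSpace U] {π θ : Γ →* (U ≃ᵢ U)}
    (hU : IsRationalUrysohn U) (hπ : IsRich π) (hθ : IsRich θ) : θ ∈ conjOrbit π := by
  have := hU.countable
  let _ := Encodable.ofCountable (U ⊕ U)
  let 𝒟 : U ⊕ U → Order.Cofinal (PartialConj π θ)
    | .inl x => ⟨{f | ∃ y, (x, y) ∈ f.1}, fun f => by
        obtain ⟨f', h1, h2⟩ := f.exists_mem_dom hU hπ.finite_orbit hθ x
        exact ⟨f', h2, h1⟩⟩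
    | .inr y => ⟨{f | ∃ x, (x, y) ∈ f.1}, fun f => by
        obtain ⟨f', h1, x, h2⟩ := f.symm.exists_mem_dom hU hθ.finite_orbit hπ y
        refine ⟨f'.symm, ⟨x, PartialConj.mem_symm.2 h2⟩, ?_⟩
        rintro ⟨a, b⟩ h
        exact PartialConj.mem_symm.2 (h1 (PartialConj.mem_symm.2 h))⟩
  let I := Order.idealOfCofinals (⟨∅, by simp, by simp⟩ : PartialConj π θ) 𝒟
  let R : U → U → Prop := fun x y => ∃ f ∈ I, (x, y) ∈ f.1
  have hR : ∀ x y x' y', R x y → R x' y' → dist x x' = dist y y' := by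
    rintro x y x' y' ⟨f, hf, h⟩ ⟨f', hf', h'⟩
    obtain ⟨k, -, h1, h2⟩ := I.directed f hf f' hf'
    exact k.2.1 _ (h1 h) _ (h2 h')
  have h1 : ∀ x, ∃ y, R x y := by
    intro x
    obtain ⟨f, ⟨y, hy⟩, hf⟩ := Order.cofinal_meets_idealOfCofinals _ 𝒟 (.inl x)
    exact ⟨y, f, hf, hy⟩
  have h2 : ∀ y, ∃ x, R x y := by
    intro y
    obtain ⟨f, ⟨x, hx⟩, hf⟩ := Order.cofinal_meets_idealOfCofinals _ 𝒟 (.inr y)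
    exact ⟨x, f, hf, hx⟩
  choose F hF using h1
  choose G hG using h2
  have huniq : ∀ x y y', R x y → R x y' → y = y' := by
    intro x y y' h h'
    have := hR _ _ _ _ h h'
    rw [dist_self] at this
    exact dist_eq_zero.1 this.symm
  let a : U ≃ᵢ U := IsometryEquiv.mk' F G (fun y => huniq _ _ _ (hF _) (hG y))
    (Isometry.of_dist_eq fun x x' => (hR _ _ _ _ (hF x) (hF x')).symm)
  refine ⟨a, fun g => ?_⟩
  rw [mul_inv_eq_iff_eq_mul]
  ext x
  obtain ⟨f, hf, h⟩ := hF x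
  exact huniq _ _ _ (hF (π g x)) ⟨f, hf, f.2.2 g _ h⟩

/-! ### The topology of the space of representations -/

section Topology

variable {Γ U : Type*} [Group Γ] [MetricSpace U]

theorem isOpen_setOf_rep_apply_eq (g : Γ) (x y : U) :
    IsOpen {π : Γ →* (U ≃ᵢ U) | π g x = y} := by
  have h1 : IsOpen {h : U ≃ᵢ U | h x = y} := by
    rcases Set.eq_empty_or_nonempty {h : U ≃ᵢ U | h x = y} with h | ⟨f, hf⟩
    · rw [h]; exact isOpen_empty
    · refine TopologicalSpace.isOpen_generateFrom_of_mem ⟨f, {x}, ?_⟩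
      ext h
      simp [show f x = y from hf]
  have h2 : Continuous fun (π : Γ →* (U ≃ᵢ U)) (g : Γ) => π g := continuous_induced_dom
  exact h1.preimage ((continuous_apply g).comp h2)

theorem isOpen_setOf_rep_apply_eq_on (S : Finset Γ) (B : Finset U) (e : U → U) (F : Γ → U → U) :
    IsOpen {π : Γ →* (U ≃ᵢ U) | ∀ g ∈ S, ∀ b ∈ B, π g (e b) = F g b} := by
  have : {π : Γ →* (U ≃ᵢ U) | ∀ g ∈ S, ∀ b ∈ B, π g (e b) = F g b} =
      ⋂ g ∈ S, ⋂ b ∈ B, {π : Γ →* (U ≃ᵢ U) | π g (e b) = F g b} := by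
    ext π; simp
  rw [this]
  exact isOpen_biInter_finset fun g _ => isOpen_biInter_finset fun b _ =>
    isOpen_setOf_rep_apply_eq g _ _

/-- Open sets of representations are determined by finitely many values. -/
theorem IsOpen.exists_finset_rep {O : Set (Γ →* (U ≃ᵢ U))} (hO : IsOpen O) {π : Γ →* (U ≃ᵢ U)}
    (hπ : π ∈ O) : ∃ (F : Finset Γ) (A : Finset U),
      ∀ θ : Γ →* (U ≃ᵢ U), (∀ g ∈ F, ∀ x ∈ A, θ g x = π g x) → θ ∈ O := by
  classical
  -- In `t` the claim is the definition of openness, so it suffices that `t` is finer than the given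
  -- topology, which is checked on subbasic sets.
  let t : TopologicalSpace (Γ →* (U ≃ᵢ U)) :=
    { IsOpen := fun O => ∀ π ∈ O, ∃ (F : Finset Γ) (A : Finset U),
        ∀ θ : Γ →* (U ≃ᵢ U), (∀ g ∈ F, ∀ x ∈ A, θ g x = π g x) → θ ∈ O
      isOpen_univ := fun _ _ => ⟨∅, ∅, fun _ _ => trivial⟩
      isOpen_inter := by
        intro s s' hs hs' π hπ
        obtain ⟨F, A, h⟩ := hs π hπ.1
        obtain ⟨F', A', h'⟩ := hs' π hπ.2
        exact ⟨F ∪ F', A ∪ A', fun θ hθ => ⟨h θ fun g hg x hx => hθ g (Finset.mem_union_left _ hg)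
          x (Finset.mem_union_left _ hx), h' θ fun g hg x hx => hθ g (Finset.mem_union_right _ hg)
          x (Finset.mem_union_right _ hx)⟩⟩
      isOpen_sUnion := by
        rintro s hs π ⟨u, hu, hπ⟩
        obtain ⟨F, A, h⟩ := hs u hu π hπ
        exact ⟨F, A, fun θ hθ => ⟨u, hu, h θ hθ⟩⟩ }
  have ht : t ≤ repTopology Γ (U ≃ᵢ U) := by
    refine continuous_iff_le_induced.1 ?_
    refine @continuous_pi _ _ _ t _ _ fun g => ?_
    refine continuous_generateFrom_iff.2 ?_
    rintro _ ⟨f, A, rfl⟩ π hπ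
    refine ⟨{g}, A, fun θ hθ x hx => ?_⟩
    exact (hθ g (Finset.mem_singleton_self g) x hx).trans (hπ x hx)
  exact ht O hO π hπ

/-- The permutations underlying isometries. -/
def isomToPerm (U : Type*) [MetricSpace U] : (U ≃ᵢ U) →* Equiv.Perm U where
  toFun := IsometryEquiv.toEquiv
  map_one' := rfl
  map_mul' _ _ := rfl

/-- Agreement with `π` for finitely many generators along the finite orbit of `x` already forces the
orbit to be the same. -/
theorem isOpen_setOf_finite_orbit [Group.FG Γ] (x : U) :
    IsOpen {π : Γ →* (U ≃ᵢ U) | (Set.range fun g : Γ => π g x).Finite} := by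
  obtain ⟨S, hS⟩ := Group.fg_def.1 (inferInstance : Group.FG Γ)
  refine isOpen_iff_forall_mem_open.2 fun π (hπ : Set.Finite _) => ⟨_, ?_,
    isOpen_setOf_rep_apply_eq_on S hπ.toFinset id fun g y => π g y, fun _ _ _ _ => rfl⟩
  intro θ hθ
  have key := MonoidHom.apply_map_eq_of_closure_eq_top (e := id) hS
    (α := (isomToPerm U).comp π) (β := (isomToPerm U).comp θ) (s := Set.range fun g => π g x)
    (by
      rintro g _ ⟨h, rfl⟩
      refine ⟨g * h, ?_⟩
      dsimp only
      rw [map_mul]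
      rfl)
    (fun g hg y hy => hθ g hg y ((Set.Finite.mem_toFinset _).2 hy))
  refine hπ.subset ?_
  rintro _ ⟨g, rfl⟩
  exact ⟨g, (key g x ⟨1, by simp⟩).symm⟩

/-- For each of the countably many pairs `(q, A)` the embedding requirement is open. A witness `ψ`
persists as long as the generators act correctly on the finite image of `q.carrier`, and a
disagreement with `q` on `A` persists by fixing one value. -/
theorem isGδ_setOf_isRich (hU : IsRationalUrysohn U) [Group.FG Γ] :
    IsGδ {π : Γ →* (U ≃ᵢ U) | IsRich π} := by
  have := hU.countable
  obtain ⟨S, hS⟩ := Group.fg_def.1 (inferInstance : Group.FG Γ)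
  let R : FinAction Γ U × Finset U → Set (Γ →* (U ≃ᵢ U)) := fun a => {π |
    a.2 ⊆ a.1.carrier → (∀ g, ∀ x ∈ a.2, a.1.act g x ∈ a.2) →
      (∀ g, ∀ x ∈ a.2, π g x = a.1.act g x) → ∃ ψ : U → U, (∀ x ∈ a.2, ψ x = x) ∧
        (∀ b ∈ a.1.carrier, ∀ b' ∈ a.1.carrier, dist (ψ b) (ψ b') = dist b b') ∧
        ∀ g, ∀ b ∈ a.1.carrier, π g (ψ b) = ψ (a.1.act g b)}
  have hR : ∀ a, IsOpen (R a) := by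
    rintro ⟨q, A⟩
    refine isOpen_iff_forall_mem_open.2 fun π hπ => ?_
    by_cases h : A ⊆ q.carrier ∧ (∀ g, ∀ x ∈ A, q.act g x ∈ A) ∧
        ∀ g, ∀ x ∈ A, π g x = q.act g x
    · obtain ⟨ψ, h1, h2, h3⟩ := hπ h.1 h.2.1 h.2.2
      refine ⟨_, fun θ hθ _ _ _ => ⟨ψ, h1, h2, ?_⟩,
        isOpen_setOf_rep_apply_eq_on S q.carrier ψ fun g b => ψ (q.act g b),
        fun g _ b hb => h3 g b hb⟩
      exact MonoidHom.apply_map_eq_of_closure_eq_top (e := ψ) hS (α := q.act)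
        (β := (isomToPerm U).comp θ) (s := q.carrier) q.mapsTo hθ
    by_cases h' : A ⊆ q.carrier ∧ ∀ g, ∀ x ∈ A, q.act g x ∈ A
    · have : ∃ g, ∃ x ∈ A, π g x ≠ q.act g x := by
        by_contra! h''
        exact h ⟨h'.1, h'.2, h''⟩
      obtain ⟨g, x, hx, hgx⟩ := this
      refine ⟨_, fun θ hθ _ _ h3 => ?_, isOpen_setOf_rep_apply_eq g x (π g x), rfl⟩
      exact absurd ((h3 g x hx).symm.trans hθ).symm hgx
    · exact ⟨Set.univ, fun θ _ h1 h2 => absurd ⟨h1, h2⟩ h', isOpen_univ, trivial⟩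
  have heq : {π : Γ →* (U ≃ᵢ U) | IsRich π} =
      (⋂ x : U, {π : Γ →* (U ≃ᵢ U) | (Set.range fun g : Γ => π g x).Finite}) ∩ ⋂ a, R a := by
    ext π
    simp only [Set.mem_inter_iff, Set.mem_iInter]
    exact ⟨fun h => ⟨h.finite_orbit, fun a => h.exists_embedding a.1 a.2⟩,
      fun h => ⟨h.1, fun q A => h.2 (q, A)⟩⟩
  rw [heq]
  exact (IsGδ.iInter_of_isOpen fun x => isOpen_setOf_finite_orbit x).inter
    (IsGδ.iInter_of_isOpen hR)

/-- If all representations are approximated by finite actions, rich representations are generic. -/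
theorem IsRich.isGenericRep (hU : IsRationalUrysohn U) [Group.FG Γ]
    (h : ∀ (π : Γ →* (U ≃ᵢ U)) (F : Finset Γ) (A : Finset U),
      ∃ p : FinAction Γ U, A ⊆ p.carrier ∧ ∀ g ∈ F, ∀ x ∈ A, p.act g x = π g x)
    {π : Γ →* (U ≃ᵢ U)} (hπ : IsRich π) : IsGenericRep π := by
  refine Filter.mem_of_superset (residual_of_dense_Gδ (isGδ_setOf_isRich hU) ?_)
    fun θ (hθ : IsRich θ) => hπ.mem_conjOrbit hU hθ
  refine dense_iff_inter_open.2 fun O hO ⟨θ, hθ⟩ => ?_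
  obtain ⟨F, A, hFA⟩ := hO.exists_finset_rep hθ
  obtain ⟨p, h1, h2⟩ := h θ F A
  obtain ⟨τ, h3, h4⟩ := p.exists_isRich hU
  exact ⟨τ, hFA τ fun g hg x hx => by rw [h4 g x (h1 hx), h2 g hg x hx], h3⟩

end Topology

/-! ### Separation in the profinite topology -/

section Profinite

variable {Γ : Type*} [Group Γ]

/-- Cosets of `K` and `L` through a common point meet in a coset of `K ⊓ L`, so the generating
cosets form a base. -/
theorem exists_smul_subset_of_isOpen_profinite {O : Set Γ}
    (hO : @IsOpen Γ (profiniteTopology Γ) O) {g : Γ} (hg : g ∈ O) :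
    ∃ K : Subgroup Γ, K.Normal ∧ K.FiniteIndex ∧ g • (K : Set Γ) ⊆ O := by
  change TopologicalSpace.GenerateOpen _ O at hO
  induction hO with
  | basic s hs =>
    obtain ⟨K, x, h1, h2, rfl⟩ := hs
    refine ⟨K, h1, h2, ?_⟩
    rw [mem_leftCoset_iff] at hg
    rw [(leftCoset_eq_iff K).2 hg]
  | univ => exact ⟨⊤, inferInstance, inferInstance, Set.subset_univ _⟩
  | inter s t _ _ ihs iht =>
    obtain ⟨K, _, _, h3⟩ := ihs hg.1
    obtain ⟨L, _, _, h6⟩ := iht hg.2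
    refine ⟨K ⊓ L, inferInstance, inferInstance, Set.subset_inter ?_ ?_⟩
    · exact (Set.smul_set_mono inf_le_left).trans h3
    · exact (Set.smul_set_mono inf_le_right).trans h6
  | sUnion S _ ih =>
    obtain ⟨s, hs, hgs⟩ := hg
    obtain ⟨K, h1, h2, h3⟩ := ih s hs hgs
    exact ⟨K, h1, h2, h3.trans (Set.subset_sUnion_of_mem hs)⟩

/-- A right translate of a product of finitely generated subgroups. -/
def IsFGProduct (S : Set Γ) : Prop :=
  ∃ (l : List (Subgroup Γ)) (g : Γ), (∀ H ∈ l, H.FG) ∧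
    S = (l.map (fun H : Subgroup Γ => (H : Set Γ))).prod * {g}

theorem isFGProduct_one : IsFGProduct (1 : Set Γ) :=
  ⟨[], 1, by simp, by simp [Set.singleton_one]⟩

theorem fg_subgroup_map {H : Subgroup Γ} (hH : H.FG) (f : Γ →* Γ) : (H.map f).FG := by
  classical
  obtain ⟨S, rfl⟩ := hH
  exact ⟨S.image f, by rw [MonoidHom.map_closure, Finset.coe_image]⟩

theorem image_conj_list_prod (c : Γ) (l : List (Subgroup Γ)) :
    MulAut.conj c '' (l.map (fun H : Subgroup Γ => (H : Set Γ))).prod =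
      ((l.map (Subgroup.map (MulAut.conj c).toMonoidHom)).map
        (fun H : Subgroup Γ => (H : Set Γ))).prod := by
  induction l with
  | nil => simp [Set.singleton_one]
  | cons H l ih =>
    rw [List.map_cons, List.prod_cons, Set.image_mul, ih]
    rfl

/-- The left factor is `x H y = (x H x⁻¹) (x y)`. Moving `x y` to the far right conjugates every
remaining subgroup and leaves a single translating element. -/
theorem IsFGProduct.coset_mul {S : Set Γ} (hS : IsFGProduct S) {H : Subgroup Γ} (hH : H.FG)
    (x y : Γ) : IsFGProduct ({γ | x⁻¹ * γ * y⁻¹ ∈ H} * S) := by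
  classical
  obtain ⟨l, g, hl, rfl⟩ := hS
  refine ⟨H.map (MulAut.conj x).toMonoidHom ::
    l.map (Subgroup.map (MulAut.conj (x * y)).toMonoidHom), x * y * g, ?_, ?_⟩
  · intro K hK
    rcases List.mem_cons.1 hK with rfl | hK
    · exact fg_subgroup_map hH _
    · obtain ⟨L, hL, rfl⟩ := List.mem_map.1 hK
      exact fg_subgroup_map (hl L hL) _
  · rw [List.map_cons, List.prod_cons, ← image_conj_list_prod]
    ext γ
    simp only [Set.mem_mul, Set.mem_singleton_iff]
    constructor
    · rintro ⟨u, hu, _, ⟨p, hp, _, rfl, rfl⟩, rfl⟩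
      refine ⟨_, ⟨x * (x⁻¹ * u * y⁻¹) * x⁻¹, ⟨_, hu, rfl⟩, _, ⟨p, hp, rfl⟩, rfl⟩, _, rfl, ?_⟩
      rw [MulAut.conj_apply]
      group
    · rintro ⟨_, ⟨_, ⟨u, hu, rfl⟩, _, ⟨p, hp, rfl⟩, rfl⟩, _, rfl, rfl⟩
      refine ⟨x * u * y, ?_, _, ⟨p, hp, _, rfl, rfl⟩, ?_⟩
      · change x⁻¹ * (x * u * y) * y⁻¹ ∈ H
        have : x⁻¹ * (x * u * y) * y⁻¹ = u := by group
        rw [this]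
        exact hu
      · change _ = MulAut.conj x u * _ * _
        rw [MulAut.conj_apply, MulAut.conj_apply]
        group

/-- With `S = P g`, the hypothesis says `g⁻¹ ∉ P`. As `P` is closed, some coset `g⁻¹ K` misses it,
and normality turns this into `K` missing `P g`. -/
theorem HasRZ.exists_disjoint (hΓ : HasRZ Γ) {S : Set Γ} (hS : IsFGProduct S)
    (h1 : (1 : Γ) ∉ S) : ∃ K : Subgroup Γ, K.Normal ∧ K.FiniteIndex ∧ ∀ k ∈ K, k ∉ S := by
  obtain ⟨l, g, hl, rfl⟩ := hS
  have hO := (hΓ l hl).isOpen_compl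
  obtain ⟨K, hK, hK', h⟩ := exists_smul_subset_of_isOpen_profinite hO (g := g⁻¹) (by
    intro h
    exact h1 ⟨_, h, g, rfl, by simp⟩)
  refine ⟨K, hK, hK', ?_⟩
  rintro k hk ⟨p, hp, x, hx, hpk⟩
  obtain rfl : p * g = k := by rw [← hpk, Set.mem_singleton_iff.1 hx]
  refine h (a := p) ⟨g * (p * g) * g⁻¹, hK.conj_mem _ hk g, ?_⟩ hp
  simp [mul_assoc]

end Profinite

/-! ### Routes between cosets -/

section Routes

variable {Γ A I : Type*} [Group Γ] (rep : A → I) (t : A → Γ)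

/-- The elements moving the coset point of `b` to that of `a`. -/
def linkSet (G : I → Subgroup Γ) (a b : A) : Set Γ :=
  {γ | rep a = rep b ∧ (t a)⁻¹ * γ * t b ∈ G (rep a)}

/-- The elements `γ` for which the edges of `l` can be translated to form a route from the point
of `a` to the `γ`-translate of the point of `b`. -/
def routeSet (G : I → Subgroup Γ) : A → List (A × A) → A → Set Γ
  | a, [], b => linkSet rep t G a b
  | a, e :: l, b => linkSet rep t G a e.1 * routeSet G e.2 l b

variable {rep t}

theorem linkSet_mul_isFGProduct {G : I → Subgroup Γ} (hG : ∀ i, (G i).FG) (a b : A) {S : Set Γ}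
    (hS : IsFGProduct S ∨ S = ∅) :
    IsFGProduct (linkSet rep t G a b * S) ∨ linkSet rep t G a b * S = ∅ := by
  rcases hS with hS | rfl
  · by_cases h : rep a = rep b
    · left
      convert hS.coset_mul (hG (rep a)) (t a) (t b)⁻¹ using 3
      ext γ
      simp [linkSet, h]
    · right
      have : linkSet rep t G a b = ∅ := by ext γ; simp [linkSet, h]
      rw [this, Set.empty_mul]
  · right; exact Set.mul_empty

theorem routeSet_isFGProduct {G : I → Subgroup Γ} (hG : ∀ i, (G i).FG) (a : A) (l : List (A × A))
    (b : A) : IsFGProduct (routeSet rep t G a l b) ∨ routeSet rep t G a l b = ∅ := by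
  induction l generalizing a with
  | nil =>
    have := linkSet_mul_isFGProduct (rep := rep) (t := t) hG a b (Or.inl isFGProduct_one)
    rwa [mul_one] at this
  | cons e l ih => exact linkSet_mul_isFGProduct hG a e.1 (ih e.2)

theorem linkSet_sup_subset {G : I → Subgroup Γ} (K : Subgroup Γ) [hK : K.Normal] (a b : A) :
    linkSet rep t (fun i => K ⊔ G i) a b ⊆ (K : Set Γ) * linkSet rep t G a b := by
  rintro γ ⟨h1, h2⟩
  obtain ⟨k, hk, x, hx, h⟩ := Subgroup.mem_sup_of_normal_left.1 h2
  refine ⟨t a * k * (t a)⁻¹, hK.conj_mem k hk _, t a * x * (t b)⁻¹, ⟨h1, ?_⟩, ?_⟩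
  · have : (t a)⁻¹ * (t a * x * (t b)⁻¹) * t b = x := by group
    rw [this]; exact hx
  · have : x = k⁻¹ * ((t a)⁻¹ * γ * t b) := by rw [← h]; group
    dsimp only
    rw [this]; group

/-- Normality lets all the factors from `K` be collected on the left, so enlarging every subgroup by
`K` costs just one factor `K`. -/
theorem routeSet_sup_subset {G : I → Subgroup Γ} (K : Subgroup Γ) [hK : K.Normal] (a : A)
    (l : List (A × A)) (b : A) :
    routeSet rep t (fun i => K ⊔ G i) a l b ⊆ (K : Set Γ) * routeSet rep t G a l b := by
  induction l generalizing a with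
  | nil => exact linkSet_sup_subset K a b
  | cons e l ih =>
    rintro _ ⟨u, hu, v, hv, rfl⟩
    obtain ⟨k, hk, x, hx, rfl⟩ := linkSet_sup_subset K a e.1 hu
    obtain ⟨k', hk', y, hy, rfl⟩ := ih e.2 hv
    refine ⟨k * (x * k' * x⁻¹), K.mul_mem hk (hK.conj_mem k' hk' x), x * y, ⟨x, hx, y, hy, rfl⟩, ?_⟩
    dsimp only
    group

/-- In a group with property (RZ), routes of bounded length between cosets of finitely generated
subgroups are detected modulo a normal subgroup of finite index. -/
theorem HasRZ.exists_finiteIndex_route (hΓ : HasRZ Γ) [Finite A] {G : I → Subgroup Γ}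
    (hG : ∀ i, (G i).FG) (C : ℕ) :
    ∃ K : Subgroup Γ, K.Normal ∧ K.FiniteIndex ∧ ∀ a l b, l.length < C →
      1 ∈ routeSet rep t (fun i => K ⊔ G i) a l b → 1 ∈ routeSet rep t G a l b := by
  have : ∀ (a : A) l (b : A), ∃ K : Subgroup Γ, K.Normal ∧ K.FiniteIndex ∧
      (1 ∉ routeSet rep t G a l b → ∀ k ∈ K, k ∉ routeSet rep t G a l b) := by
    intro a l b
    by_cases h : 1 ∈ routeSet rep t G a l b
    · exact ⟨⊤, inferInstance, inferInstance, fun h' => absurd h h'⟩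
    rcases routeSet_isFGProduct (rep := rep) (t := t) hG a l b with h' | h'
    · obtain ⟨K, h1, h2, h3⟩ := hΓ.exists_disjoint h' h
      exact ⟨K, h1, h2, fun _ => h3⟩
    · exact ⟨⊤, inferInstance, inferInstance, fun _ => by simp [h']⟩
  choose K hK1 hK2 hK3 using this
  -- The bound on the length leaves finitely many routes, so the intersection of their separating
  -- subgroups still has finite index.
  have hfin : Finite {l : List (A × A) // l.length < C} :=
    (List.finite_length_lt (A × A) C).to_subtype
  have : (⨅ x : A × {l : List (A × A) // l.length < C} × A, K x.1 x.2.1 x.2.2).Normal :=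
    Subgroup.normal_iInf_normal fun x => hK1 _ _ _
  refine ⟨⨅ x : A × {l : List (A × A) // l.length < C} × A, K x.1 x.2.1 x.2.2, this,
    Subgroup.finiteIndex_iInf fun x => hK2 _ _ _, fun a l b hl h => ?_⟩
  by_contra h'
  obtain ⟨k, hk, x, hx, hkx⟩ := routeSet_sup_subset _ a l b h
  refine hK3 a l b h' k⁻¹ ((K a l b).inv_mem ((Subgroup.mem_iInf.1 hk) (a, ⟨l, hl⟩, b))) ?_
  rwa [inv_eq_of_mul_eq_one_right hkx]

end Routes

/-! ### Path metrics -/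

/-- There is a path of total weight `n`. -/
inductive WPath {Z : Type*} (E : ℕ → Z → Z → Prop) : ℕ → Z → Z → Prop
  | nil (z : Z) : WPath E 0 z z
  | cons {n m : ℕ} {x y z : Z} : E n x y → WPath E m y z → WPath E (n + m) x z

namespace WPath

variable {Z : Type*} {E : ℕ → Z → Z → Prop}

theorem single {n : ℕ} {x y : Z} (h : E n x y) : WPath E n x y := cons h (nil y)

theorem trans {n m : ℕ} {x y z : Z} (h : WPath E n x y) (h' : WPath E m y z) :
    WPath E (n + m) x z := by
  induction h with
  | nil => rwa [zero_add]
  | cons h _ ih => rw [add_assoc]; exact cons h (ih h')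

theorem symm (hE : ∀ n x y, E n x y → E n y x) {n : ℕ} {x y : Z} (h : WPath E n x y) :
    WPath E n y x := by
  induction h with
  | nil => exact nil _
  | cons h _ ih => rw [add_comm]; exact ih.trans (single (hE _ _ _ h))

theorem map {f : Z → Z} (hE : ∀ n x y, E n x y → E n (f x) (f y)) {n : ℕ} {x y : Z}
    (h : WPath E n x y) : WPath E n (f x) (f y) := by
  induction h with
  | nil => exact nil _
  | cons h _ ih => exact cons (hE _ _ _ h) ih

theorem eq_of_zero (hE : ∀ x y, E 0 x y → x = y) {n : ℕ} {x y : Z} (h : WPath E n x y)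
    (hn : n = 0) : x = y := by
  induction h with
  | nil => rfl
  | cons h _ ih =>
    obtain ⟨rfl, rfl⟩ := Nat.add_eq_zero_iff.1 hn
    exact (hE _ _ h).trans (ih rfl)

end WPath

/-- The least weight of a path. -/
noncomputable def pathDist {Z : Type*} (E : ℕ → Z → Z → Prop) (x y : Z) : ℕ :=
  sInf {n | WPath E n x y}

section pathDist

variable {Z : Type*} {E : ℕ → Z → Z → Prop}

theorem pathDist_le {n : ℕ} {x y : Z} (h : WPath E n x y) : pathDist E x y ≤ n := Nat.sInf_le h

theorem wPath_pathDist (h : ∀ x y, ∃ n, E n x y) (x y : Z) : WPath E (pathDist E x y) x y := by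
  obtain ⟨n, hn⟩ := h x y
  exact Nat.sInf_mem (s := {n | WPath E n x y}) ⟨n, WPath.single hn⟩

/-- Weights are natural numbers, so the infimum is attained by a path, whence positivity. Dividing
by `N` undoes a clearing of denominators. -/
theorem isRationalMetric_pathDist (h : ∀ x y, ∃ n, E n x y) (hE : ∀ n x y, E n x y → E n y x)
    (h0 : ∀ x y, E 0 x y → x = y) {N : ℕ} (hN : 0 < N) :
    IsRationalMetric fun x y => (pathDist E x y / N : ℝ) where
  self x := by
    have : pathDist E x x = 0 := Nat.le_zero.1 (pathDist_le (WPath.nil x))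
    simp [this]
  pos x y hxy := by
    have : 0 < pathDist E x y := Nat.pos_of_ne_zero fun h' =>
      hxy ((wPath_pathDist h x y).eq_of_zero h0 h')
    positivity
  symm x y := by
    have : pathDist E x y = pathDist E y x :=
      le_antisymm (pathDist_le ((wPath_pathDist h y x).symm hE))
        (pathDist_le ((wPath_pathDist h x y).symm hE))
    simp [this]
  tri x y z := by
    have := pathDist_le ((wPath_pathDist h x y).trans (wPath_pathDist h y z))
    rw [← add_div]
    gcongr
    exact_mod_cast this
  rat x y := ⟨pathDist E x y / N, by push_cast; rfl⟩

end pathDist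

/-! ### Finite coset spaces -/

section CosetSpace

variable {Γ A I : Type*} [Group Γ] (rep : A → I) (t : A → Γ) (G : I → Subgroup Γ)

/-- The point of the disjoint union of coset spaces that corresponds to `a`. -/
def cosetPoint (a : A) : Σ i, Γ ⧸ G i := ⟨rep a, (t a : Γ ⧸ G (rep a))⟩

/-- This is the dictionary between geometry and algebra: consecutive translated edges fit together
exactly when a group element lies in `linkSet`. -/
theorem smul_cosetPoint_eq_iff {γ γ' : Γ} {a b : A} :
    γ • cosetPoint rep t G a = γ' • cosetPoint rep t G b ↔ γ⁻¹ * γ' ∈ linkSet rep t G a b := by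
  have key : ∀ (i j : I) (x y : Γ), (⟨i, (x : Γ ⧸ G i)⟩ : Σ i, Γ ⧸ G i) = ⟨j, (y : Γ ⧸ G j)⟩ ↔
      i = j ∧ x⁻¹ * y ∈ G i := by
    intro i j x y
    constructor
    · intro h
      obtain rfl : i = j := congrArg Sigma.fst h
      exact ⟨rfl, QuotientGroup.eq.1 (eq_of_heq (Sigma.mk.inj h).2)⟩
    · rintro ⟨rfl, h⟩
      rw [QuotientGroup.eq.2 h]
  have h := key (rep a) (rep b) (γ * t a) (γ' * t b)
  have e : (γ * t a)⁻¹ * (γ' * t b) = (t a)⁻¹ * (γ⁻¹ * γ') * t b := by group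
  rw [e] at h
  exact h

/-- Translates of the edges between the points `cosetPoint a`, with weights `d`, together with
edges of weight `C` between any two points. -/
def cosetEdge (d : A → A → ℕ) (C : ℕ) (n : ℕ) (z z' : Σ i, Γ ⧸ G i) : Prop :=
  (∃ (γ : Γ) (a b : A), z = γ • cosetPoint rep t G a ∧ z' = γ • cosetPoint rep t G b ∧ n = d a b) ∨
    n = C

variable {rep t G}

/-- A path of weight below `C` uses no edge of weight `C`, so all its edges are translates of pairs
from `A`. Matching their endpoints gives one link condition per junction, and the translating
elements telescope to `γ⁻¹`. -/
theorem WPath.exists_route {d : A → A → ℕ} (hd : ∀ a b, d a b = 0 → a = b) {C n : ℕ}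
    {z z' : Σ i, Γ ⧸ G i} (h : WPath (cosetEdge rep t G d C) n z z') :
    ∀ (γ : Γ) (a b : A), z = γ • cosetPoint rep t G a → z' = cosetPoint rep t G b → n < C →
      ∃ l : List (A × A), l.length ≤ n ∧ (l.map fun e => d e.1 e.2).sum ≤ n ∧
        γ⁻¹ ∈ routeSet rep t G a l b := by
  induction h with
  | nil z =>
    rintro γ a b h1 h2 -
    refine ⟨[], by simp, by simp, ?_⟩
    rw [← mul_one γ⁻¹]
    refine (smul_cosetPoint_eq_iff rep t G).1 ?_
    rw [← h1, h2, one_smul]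
  | @cons n m x y z h _ ih =>
    intro γ a b h1 h2 hC
    rcases h with ⟨δ, c, e, h3, h4, h5⟩ | h
    -- Edges of weight zero are degenerate and are dropped, so that the weight bounds the number of
    -- edges.
    · by_cases h0 : n = 0
      · obtain rfl := hd c e (h5.symm.trans h0)
        obtain ⟨l, h6, h7, h8⟩ := ih γ a b (h4.trans (h3.symm.trans h1)) h2 (by omega)
        exact ⟨l, by omega, by omega, h8⟩
      · obtain ⟨l, h6, h7, h8⟩ := ih δ e b h4 h2 (by omega)
        refine ⟨(c, e) :: l, by simp; omega, by simp; omega, γ⁻¹ * δ,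
          (smul_cosetPoint_eq_iff rep t G).1 (h1.symm.trans h3), δ⁻¹, h8, ?_⟩
        simp
    · omega

end CosetSpace

/-- A path shorter than the direct edge would have weight below `C`, hence give a short route, which
`hroute` excludes. -/
theorem pathDist_cosetPoint {Γ A I : Type*} [Group Γ] {rep : A → I} {t : A → Γ}
    {G : I → Subgroup Γ} {d : A → A → ℕ} (hd : ∀ a b, d a b = 0 → a = b) {C : ℕ}
    (hC : ∀ a b, d a b < C) (hroute : ∀ a l b, l.length < C → 1 ∈ routeSet rep t G a l b →
      d a b ≤ (l.map fun e => d e.1 e.2).sum) (a b : A) :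
    pathDist (cosetEdge rep t G d C) (cosetPoint rep t G a) (cosetPoint rep t G b) = d a b := by
  apply le_antisymm
  · exact pathDist_le (WPath.single (Or.inl ⟨1, a, b, by simp, by simp, rfl⟩))
  · by_contra! h
    have h1 := wPath_pathDist (E := cosetEdge rep t G d C) (fun _ _ => ⟨C, Or.inr rfl⟩)
      (cosetPoint rep t G a) (cosetPoint rep t G b)
    have hlt := h.trans (hC a b)
    obtain ⟨l, h2, h3, h4⟩ := h1.exists_route hd 1 a b (one_smul _ _).symm rfl hlt
    rw [inv_one] at h4
    have := hroute a l b (h2.trans_lt hlt) h4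
    omega

/-! ### Approximation of isometric actions by finite actions -/

theorem exists_nat_mul_eq_of_rat {ι : Type*} [Finite ι] {f : ι → ℝ} (hf : ∀ i, ∃ q : ℚ, f i = q)
    (h0 : ∀ i, 0 ≤ f i) : ∃ N : ℕ, 0 < N ∧ ∀ i, ∃ n : ℕ, f i * N = n := by
  have := Fintype.ofFinite ι
  choose q hq using hf
  refine ⟨∏ i, (q i).den, Finset.prod_pos fun i _ => (q i).den_pos, fun i => ?_⟩
  obtain ⟨k, hk⟩ := Finset.dvd_prod_of_mem (fun i => (q i).den) (Finset.mem_univ i)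
  have hq0 : 0 ≤ q i := by
    have := h0 i
    rw [hq] at this
    exact_mod_cast this
  refine ⟨(q i).num.toNat * k, ?_⟩
  have h1 : ((q i).num.toNat : ℤ) = (q i).num := Int.toNat_of_nonneg (Rat.num_nonneg.2 hq0)
  have h2 : ((q i).num.toNat : ℚ) = (q i).num := by exact_mod_cast h1
  have h3 : q i * (∏ i, (q i).den : ℕ) = ((q i).num.toNat * k : ℕ) := by
    rw [hk]
    push_cast
    rw [h2, ← mul_assoc, Rat.mul_den_eq_num]
  rw [hq]
  exact_mod_cast h3

/-- In a group with property (RZ), isometric actions on the rational Urysohn space are approximated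
by finite actions. -/
theorem HasRZ.exists_finAction {Γ U : Type*} [Group Γ] [MetricSpace U] (hΓ : HasRZ Γ)
    (hU : IsRationalUrysohn U) (π : Γ →* (U ≃ᵢ U)) (F : Finset Γ) (A : Finset U) :
    ∃ p : FinAction Γ U, A ⊆ p.carrier ∧ ∀ g ∈ F, ∀ x ∈ A, p.act g x = π g x := by
  classical
  have hmul : ∀ a b z, π (a * b) z = π a (π b z) := fun a b z => by rw [map_mul]; rfl
  have hone : ∀ z, π 1 z = z := fun z => by rw [map_one]; rfl
  have hinv : ∀ a z, π a⁻¹ (π a z) = z := fun a z => by rw [← hmul, inv_mul_cancel, hone]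
  let X := A ∪ (F ×ˢ A).image fun z => π z.1 z.2
  have hAX : A ⊆ X := Finset.subset_union_left
  have hFX : ∀ g ∈ F, ∀ x ∈ A, π g x ∈ X := fun g hg x hx =>
    Finset.mem_union_right _ (Finset.mem_image.2 ⟨(g, x), Finset.mk_mem_product hg hx, rfl⟩)
  obtain ⟨N, hN, hd⟩ := exists_nat_mul_eq_of_rat (f := fun x : X × X => dist (x.1 : U) x.2)
    (fun _ => hU.rational _ _) (fun _ => dist_nonneg)
  choose d' hd' using hd
  let d : X → X → ℕ := fun a b => d' (a, b)
  have hd : ∀ a b : X, dist (a : U) b * N = d a b := fun a b => hd' (a, b)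
  have hN' : (0 : ℝ) < N := by exact_mod_cast hN
  have hd0 : ∀ a b, d a b = 0 → a = b := by
    intro a b h
    have := hd a b
    rw [h, Nat.cast_zero, mul_eq_zero, dist_eq_zero] at this
    exact Subtype.ext (this.resolve_right hN'.ne')
  obtain ⟨C, hC⟩ : ∃ C, ∀ a b, d a b < C := by
    obtain ⟨C, hC⟩ := (Set.finite_range fun z : X × X => d z.1 z.2).bddAbove
    exact ⟨C + 1, fun a b => Nat.lt_succ_of_le (hC ⟨(a, b), rfl⟩)⟩
  let r : Setoid X :=
    { r := fun x y => ∃ g, π g x = y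
      iseqv := ⟨fun x => ⟨1, hone x⟩, fun ⟨g, h⟩ => ⟨g⁻¹, by rw [← h, hinv]⟩,
        fun ⟨g, h⟩ ⟨g', h'⟩ => ⟨g' * g, by rw [hmul, h, h']⟩⟩ }
  let rep : X → Quotient r := Quotient.mk r
  have ht : ∀ x : X, ∃ g, π g (Quotient.out (rep x) : X) = x := fun x => Quotient.mk_out x
  choose t ht using ht
  have hti : ∀ x : X, π (t x)⁻¹ x = (Quotient.out (rep x) : X) := fun x => by
    conv_lhs => rw [← ht x, hinv]
  -- Schreier-type generators: each fixes the base point of the orbit, and having them in the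
  -- subgroup makes `f` carry the coset point of `a` to that of `b`.
  let gens : Quotient r → Set Γ := fun i =>
    {h | ∃ f ∈ F, ∃ a b : X, π f a = b ∧ rep a = i ∧ h = (t b)⁻¹ * f * t a}
  let H : Quotient r → Subgroup Γ := fun i => Subgroup.closure (gens i)
  have hH : ∀ i, (H i).FG := by
    intro i
    refine (Subgroup.fg_iff _).2 ⟨gens i, rfl, ?_⟩
    refine (Set.finite_range fun z : F × X × X => (t z.2.2)⁻¹ * z.1 * t z.2.1).subset ?_
    rintro _ ⟨f, hf, a, b, -, -, rfl⟩
    exact ⟨(⟨f, hf⟩, a, b), rfl⟩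
  have hrep : ∀ f (a b : X), π f a = b → rep a = rep b := fun f a b h => Quotient.sound ⟨f, h⟩
  have hstab : ∀ i, ∀ h ∈ H i, π h (Quotient.out i : X) = (Quotient.out i : X) := by
    intro i h hh
    induction hh using Subgroup.closure_induction with
    | mem h hh =>
      obtain ⟨f, -, a, b, hab, rfl, rfl⟩ := hh
      rw [hmul, hmul, ht, hab, hti, hrep f a b hab]
    | one => exact hone _
    | mul a b _ _ iha ihb => rw [hmul, ihb, iha]
    | inv a _ ih => conv_lhs => rw [← ih, hinv]
  have hlink : ∀ (a b : X) γ, γ ∈ linkSet rep t H a b → π γ b = a := by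
    rintro a b γ ⟨h1, h2⟩
    have h3 := congrArg (π (t a)) (hstab _ _ h2)
    rw [← hmul, ht] at h3
    have e : t a * ((t a)⁻¹ * γ * t b) = γ * t b := by group
    rwa [e, hmul, h1, ht] at h3
  -- In the original action a route is a genuine chain of points of `U` from `a` to `π γ b`, so the
  -- triangle inequality bounds the distance.
  have hroute : ∀ (l : List (X × X)) (a b : X) γ, γ ∈ routeSet rep t H a l b →
      dist (a : U) (π γ b) * N ≤ ((l.map fun e => d e.1 e.2).sum : ℕ) := by
    intro l
    induction l with
    | nil =>
      intro a b γ h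
      rw [hlink a b γ h]
      simp
    | cons e l ih =>
      rintro a b _ ⟨γ, hγ, δ, hδ, rfl⟩
      have h1 := ih e.2 b δ hδ
      have h2 := hd e.1 e.2
      have h3 := hlink a e.1 γ hγ
      have h4 := dist_triangle (a : U) (π γ e.2) (π γ (π δ b))
      have h6 : dist (a : U) (π γ e.2) = dist (e.1 : U) e.2 := by rw [← h3, (π γ).dist_eq]
      rw [(π γ).dist_eq, h6] at h4
      dsimp only
      rw [hmul, List.map_cons, List.sum_cons, Nat.cast_add, ← h2]
      have h5 := mul_le_mul_of_nonneg_right h4 hN'.le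
      rw [add_mul] at h5
      linarith
  obtain ⟨K, hK, hK', hKr⟩ := hΓ.exists_finiteIndex_route (rep := rep) (t := t) hH C
  let G : Quotient r → Subgroup Γ := fun i => K ⊔ H i
  have hGfin : ∀ i, Finite (Γ ⧸ G i) := fun i => by
    have : (G i).FiniteIndex := Subgroup.finiteIndex_of_le (le_sup_left : K ≤ G i)
    exact Subgroup.finite_quotient_of_finiteIndex
  let pt := cosetPoint rep t G
  let E := cosetEdge rep t G d C
  have hE : ∀ n z z', E n z z' → E n z' z := by
    rintro n z z' (⟨γ, a, b, h1, h2, h3⟩ | h)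
    · refine Or.inl ⟨γ, b, a, h2, h1, ?_⟩
      have : (d a b : ℝ) = d b a := by rw [← hd, ← hd, dist_comm]
      rw [h3]
      exact_mod_cast this
    · exact Or.inr h
  have hE0 : ∀ z z', E 0 z z' → z = z' := by
    rintro z z' (⟨γ, a, b, rfl, rfl, h⟩ | h)
    · rw [hd0 a b h.symm]
    -- `C = 0` is impossible: the index of `z` is a class of some `x : X`, and `C` exceeds `d x x`.
    · by_contra
      obtain ⟨⟨x⟩, -⟩ := z
      have := hC x x
      omega
  have hEsmul : ∀ (g : Γ) n z z', E n z z' → E n (g • z) (g • z') := by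
    rintro g n z z' (⟨γ, a, b, rfl, rfl, h⟩ | h)
    · exact Or.inl ⟨g * γ, a, b, smul_smul _ _ _, smul_smul _ _ _, h⟩
    · exact Or.inr h
  have hEtot : ∀ z z', ∃ n, E n z z' := fun _ _ => ⟨C, Or.inr rfl⟩
  have hpt : ∀ a b, pathDist E (pt a) (pt b) = d a b := by
    refine pathDist_cosetPoint hd0 hC fun a l b hl h => ?_
    have := hroute l a b 1 (hKr a l b hl h)
    rw [hone, hd] at this
    exact_mod_cast this
  have hptinj : ∀ a b, pt a = pt b → a = b := by
    intro a b h
    refine hd0 a b ?_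
    rw [← hpt, h]
    exact Nat.le_zero.1 (pathDist_le (WPath.nil _))
  have hle : ∀ (g : Γ) z z', pathDist E (g • z) (g • z') ≤ pathDist E z z' := fun g z z' =>
    pathDist_le ((wPath_pathDist hEtot z z').map (hEsmul g))
  -- Only the values on the range of `pt` matter; the fallback is an arbitrary point.
  let φ : (Σ i, Γ ⧸ G i) → U := fun z => if h : ∃ a, pt a = z then h.choose else
    (Quotient.out z.1 : X)
  have hφ : ∀ a, φ (pt a) = a := by
    intro a
    have h : ∃ b, pt b = pt a := ⟨a, rfl⟩
    simp only [φ, dif_pos h]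
    exact congrArg _ (hptinj _ _ h.choose_spec)
  obtain ⟨p, ψ, h1, -, h3, h4⟩ := FinAction.exists_of_isRationalMetric hU
    (MulAction.toPermHom Γ (Σ i, Γ ⧸ G i))
    (isRationalMetric_pathDist hEtot hE hE0 hN) (by
      intro g z z'
      have : pathDist E (g • z) (g • z') = pathDist E z z' := by
        refine le_antisymm (hle g z z') ?_
        have := hle g⁻¹ (g • z) (g • z')
        rwa [inv_smul_smul, inv_smul_smul] at this
      simp [this]) (Set.range pt) φ (by
      rintro _ ⟨a, rfl⟩ _ ⟨b, rfl⟩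
      rw [hφ, hφ, hpt, eq_div_iff hN'.ne', hd])
  have hψ : ∀ a, ψ (pt a) = a := fun a => (h1 _ ⟨a, rfl⟩).trans (hφ a)
  refine ⟨p, fun x hx => ?_, fun f hf x hx => ?_⟩
  · have := h3 (pt ⟨x, hAX hx⟩)
    rwa [hψ] at this
  · have h5 := h4 f (pt ⟨x, hAX hx⟩)
    have h6 : f • pt ⟨x, hAX hx⟩ = (1 : Γ) • pt ⟨π f x, hFX f hf x hx⟩ := by
      refine (smul_cosetPoint_eq_iff rep t G).2 ⟨hrep f _ _ rfl, ?_⟩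
      refine (le_sup_right : H _ ≤ G _) ?_
      -- The element required by `linkSet` is the inverse of the generator coming from `f`, `x` and
      -- `π f x`.
      rw [← (H _).inv_mem_iff]
      refine Subgroup.subset_closure ⟨f, hf, ⟨x, hAX hx⟩, ⟨π f x, hFX f hf x hx⟩, rfl, rfl, ?_⟩
      group
    rw [MulAction.toPermHom_apply, MulAction.toPerm_apply, h6, one_smul, hψ, hψ] at h5
    exact h5

/-! ### Finitely generated abelian groups -/

/-- Finitely generated abelian groups are residually finite. -/
theorem CommGroup.residuallyFinite_of_fg (Q : Type*) [CommGroup Q] [Group.FG Q] :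
    Group.ResiduallyFinite Q := by
  obtain ⟨ι, j, _, _, p, hp, e, ⟨f⟩⟩ := CommGroup.equiv_free_prod_prod_multiplicative_zmod Q
  refine Group.residuallyFinite_of_forall_exists_finite_monoidHom fun g hg => ?_
  have hfg : f g ≠ 1 := fun h => hg ((map_eq_one_iff f f.injective).1 h)
  by_cases h : (f g).2 = 1
  · have h1 : (f g).1 ≠ 1 := fun h' => hfg (Prod.ext h' h)
    obtain ⟨k, hk⟩ := Function.ne_iff.1 h1
    have hk0 : Multiplicative.toAdd ((f g).1 k) ≠ 0 := fun h' => hk (toAdd_eq_zero.1 h')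
    -- A nonzero integer is not divisible by its absolute value plus one.
    refine ⟨Multiplicative (ZMod ((Multiplicative.toAdd ((f g).1 k)).natAbs + 1)), inferInstance,
      inferInstance, (AddMonoidHom.toMultiplicative (Int.castAddHom (ZMod _))).comp
        ((Pi.evalMonoidHom _ k).comp ((MonoidHom.fst _ _).comp f.toMonoidHom)), fun h' => ?_⟩
    have h2 : ((Multiplicative.toAdd ((f g).1 k) : ℤ) :
      ZMod ((Multiplicative.toAdd ((f g).1 k)).natAbs + 1)) = 0 := h'
    rw [ZMod.intCast_zmod_eq_zero_iff_dvd, ← Int.dvd_natAbs, Int.natCast_dvd_natCast] at h2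
    have := Nat.le_of_dvd (Int.natAbs_pos.2 hk0) h2
    omega
  · have : ∀ i, NeZero (p i ^ e i) := fun i => ⟨pow_ne_zero _ (hp i).ne_zero⟩
    exact ⟨_, inferInstance, inferInstance, (MonoidHom.snd _ _).comp f.toMonoidHom, h⟩

/-- In an abelian group the product is itself a subgroup `P`. Residual finiteness of `Γ ⧸ P`
separates any `g ∉ P` from `P` by a finite-index subgroup. -/
theorem hasRZ_of_commGroup (Γ : Type*) [CommGroup Γ] [Group.FG Γ] : HasRZ Γ := by
  intro l _
  have hprod : ∃ P : Subgroup Γ, (l.map (fun H : Subgroup Γ => (H : Set Γ))).prod = P := by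
    clear * -
    induction l with
    | nil => exact ⟨⊥, by simp [Set.singleton_one]⟩
    | cons H l ih =>
      obtain ⟨P, hP⟩ := ih
      exact ⟨H ⊔ P, by rw [List.map_cons, List.prod_cons, hP, Subgroup.mul_normal]⟩
  obtain ⟨P, hP⟩ := hprod
  rw [hP]
  let _ := profiniteTopology Γ
  refine ⟨isOpen_iff_forall_mem_open.2 fun g (hg : g ∉ P) => ?_⟩
  have := CommGroup.residuallyFinite_of_fg (Γ ⧸ P)
  obtain ⟨H, hH⟩ := Group.exists_finiteIndexNormalSubgroup_notMem (g : Γ ⧸ P)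
    (fun h => hg ((QuotientGroup.eq_one_iff g).1 h))
  let K : Subgroup Γ := (H.comap (QuotientGroup.mk' P)).toSubgroup
  refine ⟨g • (K : Set Γ), ?_, TopologicalSpace.isOpen_generateFrom_of_mem
    ⟨K, g, (H.comap _).isNormal', (H.comap _).isFiniteIndex', rfl⟩, ⟨1, K.one_mem, by simp⟩⟩
  rintro _ ⟨k, hk, rfl⟩ (h : g * k ∈ P)
  refine hH ?_
  have h1 : (g : Γ ⧸ P) * k = 1 := (QuotientGroup.eq_one_iff (g * k)).2 h
  rw [eq_inv_of_mul_eq_one_left h1]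
  exact H.toSubgroup.inv_mem hk

/-! ### Existence of the generic representation -/

theorem exists_isGenericRep_finite_orbits {U : Type*} [MetricSpace U] (hU : IsRationalUrysohn U)
    {Γ : Type*} [Group Γ] [Group.FG Γ] (hΓ : HasRZ Γ) :
    ∃ π : Γ →* (U ≃ᵢ U), IsGenericRep π ∧ ∀ x : U, (Set.range fun g : Γ => π g x).Finite := by
  -- The construction starts from the action with empty carrier.
  obtain ⟨π, hπ, -⟩ := FinAction.exists_isRich hU (default : FinAction Γ U)
  exact ⟨π, hπ.isGenericRep hU (hΓ.exists_finAction hU), hπ.finite_orbit⟩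

theorem mainTheorem1 (U : Type*) [MetricSpace U] (hU : IsRationalUrysohn U)
    (Γ : Type*) [Group Γ] [Group.FG Γ] :
    (HasRZ Γ →
      ∃ π : Γ →* (U ≃ᵢ U), IsGenericRep π ∧ ∀ x : U, (Set.range fun g : Γ => π g x).Finite) ∧
    ((∀ a b : Γ, a * b = b * a) →
      HasRZ Γ ∧
        ∃ π : Γ →* (U ≃ᵢ U), IsGenericRep π ∧
          ∀ x : U, (Set.range fun g : Γ => π g x).Finite) := by
  refine ⟨exists_isGenericRep_finite_orbits hU, fun hcomm => ?_⟩
  have hΓ : HasRZ Γ := by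
    let _ : CommGroup Γ := { ‹Group Γ› with mul_comm := hcomm }
    exact hasRZ_of_commGroup Γ
  exact ⟨hΓ, exists_isGenericRep_finite_orbits hU hΓ⟩
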